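/- Let $K$ be an algebraically closed field (of arbitrary characteristic). For integers $a,b,c\ge 1$ let $SD(3\mathcal K)^{a,b,c}$ be the $K$-algebra $K\Gamma/I$, where $\Gamma$ is the quiver with three vertices $0,1,2$ and six arrows $$\beta:0\to1,\quad \gamma:1\to0,\quad \delta:1\to2,\quad \eta:2\to1,\quad \lambda:2\to0,\quad \kappa:0\to2,$$ paths are written from left to right (so $\beta\delta$ is the path $0\to1\to2$), and $I$ is the two-sided ideal of the path algebra $K\Gamma$ generated by $$\kappa\eta,\quad \eta\gamma,\quad \gamma\kappa,\quad \delta\lambda-(\gamma\beta)^{a-1}\gamma,\quad \beta\delta-(\kappa\lambda)^{b-1}\kappa,\quad \lambda\beta-(\eta\delta)^{c-1}\eta .$$ Two $K$-algebras $A$ and $B$ are called stably equivalent of Morita type if there are an $A$-$B$-bimodule $M$ and a $B$-$A$-bimodule $N$ (with $K$ acting centrally), each finitely generated and projective as a left module and as a right module, together with isomorphisms of bimodules $M\otimes_B N\simeq A\oplus P$ and $N\otimes_A M\simeq B\oplus Q$, where $P$ is a projective $A$-$A$-bimodule and $Q$ is a projective $B$-$B$-bimodule. Let $a\ge b\ge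 c\ge 1$ with $a\ge 2$, and let $a'\ge b'\ge c'\ge 1$ with $a'\ge 2$. Then $SD(3\mathcal K)^{a,b,c}$ is stably equivalent of Morita type to $SD(3\mathcal K)^{a',b',c'}$ if and only if $a=a'$, $b=b'$ and $c=c'$. -/

import Mathlib

universe u

open scoped TensorProduct

noncomputable section

/-! ### Bimodules over algebras -/

/-- An `A`-`B`-bimodule over `K`: a left `A`-module which is a right `B`-module
(that is, a left `Bᵐᵒᵖ`-module), such that the two actions commute and
`K` acts in the same way through `A` and through `B`. -/
structure AlgBimodule (K A B : Type u) [Field K] [Ring A] [Algebra K A] [Ring B] [Algebra K B] where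
  carrier : Type u
  [addCommGroup : AddCommGroup carrier]
  [moduleBase : Module K carrier]
  [moduleLeft : Module A carrier]
  [moduleRight : Module Bᵐᵒᵖ carrier]
  [smulComm : SMulCommClass A Bᵐᵒᵖ carrier]
  [towerLeft : IsScalarTower K A carrier]
  [towerRight : IsScalarTower K Bᵐᵒᵖ carrier]

namespace AlgBimodule

attribute [instance] addCommGroup moduleBase moduleLeft moduleRight smulComm towerLeft towerRight

variable {K A B C : Type u} [Field K] [Ring A] [Algebra K A] [Ring B] [Algebra K B]
  [Ring C] [Algebra K C]

instance : CoeSort (AlgBimodule K A B) (Type u) := ⟨AlgBimodule.carrier⟩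

/-- Isomorphisms of bimodules. -/
structure Iso (M N : AlgBimodule K A B) extends M ≃ₗ[K] N where
  map_left : ∀ (a : A) (m : M), toFun (a • m) = a • toFun m
  map_right : ∀ (b : Bᵐᵒᵖ) (m : M), toFun (b • m) = b • toFun m

/-- The algebra `A` as an `A`-`A`-bimodule. -/
def regular (K A : Type u) [Field K] [Ring A] [Algebra K A] : AlgBimodule K A A where
  carrier := A

/-- The direct sum of two bimodules. -/
def directSum (M N : AlgBimodule K A B) : AlgBimodule K A B where
  carrier := M × N

/-- A bimodule is projective if it is projective as a module over `A ⊗ Bᵐᵒᵖ`,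
which acts by `(a ⊗ b) • m = a • b • m`. -/
def IsProjective (M : AlgBimodule K A B) : Prop :=
  letI : Module (A ⊗[K] Bᵐᵒᵖ) M := TensorProduct.Algebra.module
  Module.Projective (A ⊗[K] Bᵐᵒᵖ) M

/-- Left multiplication by `a`, as a `K`-linear endomorphism. -/
def leftMul (M : AlgBimodule K A B) : A →ₐ[K] Module.End K M := Algebra.lsmul K K M

/-- Right multiplication by `b`, as a `K`-linear endomorphism. -/
def rightMul (M : AlgBimodule K A B) : Bᵐᵒᵖ →ₐ[K] Module.End K M := Algebra.lsmul K K M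

/-- The subspace of `M ⊗[K] N` spanned by all `(m b) ⊗ n - m ⊗ (b n)`. -/
def balancing (M : AlgBimodule K A B) (N : AlgBimodule K B C) : Submodule K (M ⊗[K] N) :=
  Submodule.span K
    {x | ∃ (m : M) (b : B) (n : N), x = (MulOpposite.op b • m) ⊗ₜ[K] n - m ⊗ₜ[K] (b • n)}

lemma balancing_le_left (M : AlgBimodule K A B) (N : AlgBimodule K B C) (a : A) :
    balancing M N ≤ (balancing M N).comap ((M.leftMul a).rTensor N) := by
  refine Submodule.span_le.2 ?_
  rintro _ ⟨m, b, n, rfl⟩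
  refine Submodule.subset_span ⟨a • m, b, n, ?_⟩
  simp [leftMul, smul_comm]

lemma balancing_le_right (M : AlgBimodule K A B) (N : AlgBimodule K B C) (c : Cᵐᵒᵖ) :
    balancing M N ≤ (balancing M N).comap ((N.rightMul c).lTensor M) := by
  refine Submodule.span_le.2 ?_
  rintro _ ⟨m, b, n, rfl⟩
  refine Submodule.subset_span ⟨m, b, c • n, ?_⟩
  simp [rightMul, smul_comm]

/-- The underlying vector space of `M ⊗_B N`. -/
def TensorCarrier (M : AlgBimodule K A B) (N : AlgBimodule K B C) : Type u :=
  (M ⊗[K] N) ⧸ balancing M N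

instance (M : AlgBimodule K A B) (N : AlgBimodule K B C) : AddCommGroup (TensorCarrier M N) :=
  inferInstanceAs (AddCommGroup ((M ⊗[K] N) ⧸ balancing M N))

instance (M : AlgBimodule K A B) (N : AlgBimodule K B C) : Module K (TensorCarrier M N) :=
  inferInstanceAs (Module K ((M ⊗[K] N) ⧸ balancing M N))

/-- The class of `m ⊗ n` in `M ⊗_B N`. -/
def tmk (M : AlgBimodule K A B) (N : AlgBimodule K B C) (m : M) (n : N) : TensorCarrier M N :=
  (balancing M N).mkQ (m ⊗ₜ[K] n)

lemma tensor_end_ext {M : AlgBimodule K A B} {N : AlgBimodule K B C}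
    {f g : Module.End K (TensorCarrier M N)}
    (h : ∀ m n, f (tmk M N m n) = g (tmk M N m n)) : f = g := by
  refine Submodule.linearMap_qext (balancing M N) ?_
  exact TensorProduct.ext' h

/-- The endomorphism `m ⊗ n ↦ (a m) ⊗ n` of `M ⊗_B N`. -/
def tensorLeft (M : AlgBimodule K A B) (N : AlgBimodule K B C) (a : A) :
    Module.End K (TensorCarrier M N) :=
  (balancing M N).mapQ (balancing M N) ((M.leftMul a).rTensor N) (balancing_le_left M N a)

/-- The endomorphism `m ⊗ n ↦ m ⊗ (n c)` of `M ⊗_B N`. -/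
def tensorRight (M : AlgBimodule K A B) (N : AlgBimodule K B C) (c : Cᵐᵒᵖ) :
    Module.End K (TensorCarrier M N) :=
  (balancing M N).mapQ (balancing M N) ((N.rightMul c).lTensor M) (balancing_le_right M N c)

lemma tensorLeft_tmk (M : AlgBimodule K A B) (N : AlgBimodule K B C) (a : A) (m : M) (n : N) :
    tensorLeft M N a (tmk M N m n) = tmk M N (a • m) n := rfl

lemma tensorRight_tmk (M : AlgBimodule K A B) (N : AlgBimodule K B C) (c : Cᵐᵒᵖ) (m : M) (n : N) :
    tensorRight M N c (tmk M N m n) = tmk M N m (c • n) := rfl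

lemma tmk_add_left (M : AlgBimodule K A B) (N : AlgBimodule K B C) (m m' : M) (n : N) :
    tmk M N (m + m') n = tmk M N m n + tmk M N m' n := by
  simp only [tmk, TensorProduct.add_tmul, map_add]; rfl

lemma tmk_add_right (M : AlgBimodule K A B) (N : AlgBimodule K B C) (m : M) (n n' : N) :
    tmk M N m (n + n') = tmk M N m n + tmk M N m n' := by
  simp only [tmk, TensorProduct.tmul_add, map_add]; rfl

lemma tmk_smul_left (M : AlgBimodule K A B) (N : AlgBimodule K B C) (k : K) (m : M) (n : N) :
    tmk M N (k • m) n = k • tmk M N m n := rfl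

lemma tmk_smul_right (M : AlgBimodule K A B) (N : AlgBimodule K B C) (k : K) (m : M) (n : N) :
    tmk M N m (k • n) = k • tmk M N m n := by
  simp only [tmk, TensorProduct.tmul_smul, map_smul]; rfl

lemma tmk_zero_left (M : AlgBimodule K A B) (N : AlgBimodule K B C) (n : N) :
    tmk M N 0 n = 0 := by
  simp only [tmk, TensorProduct.zero_tmul, map_zero]; rfl

lemma tmk_zero_right (M : AlgBimodule K A B) (N : AlgBimodule K B C) (m : M) :
    tmk M N m 0 = 0 := by
  simp only [tmk, TensorProduct.tmul_zero, map_zero]; rfl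

/-- The left action of `A` on `M ⊗_B N`. -/
def tensorLeftHom (M : AlgBimodule K A B) (N : AlgBimodule K B C) :
    A →+* Module.End K (TensorCarrier M N) where
  toFun := tensorLeft M N
  map_one' := tensor_end_ext fun m n => by simp [tensorLeft_tmk]
  map_mul' a a' := tensor_end_ext fun m n => by simp [tensorLeft_tmk, mul_smul]
  map_zero' := tensor_end_ext fun m n => by simp [tensorLeft_tmk, tmk_zero_left]
  map_add' a a' := tensor_end_ext fun m n => by simp [tensorLeft_tmk, add_smul, tmk_add_left]

/-- The right action of `C` on `M ⊗_B N`. -/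
def tensorRightHom (M : AlgBimodule K A B) (N : AlgBimodule K B C) :
    Cᵐᵒᵖ →+* Module.End K (TensorCarrier M N) where
  toFun := tensorRight M N
  map_one' := tensor_end_ext fun m n => by simp [tensorRight_tmk]
  map_mul' c c' := tensor_end_ext fun m n => by simp [tensorRight_tmk, mul_smul]
  map_zero' := tensor_end_ext fun m n => by simp [tensorRight_tmk, tmk_zero_right]
  map_add' c c' := tensor_end_ext fun m n => by simp [tensorRight_tmk, add_smul, tmk_add_right]

instance (M : AlgBimodule K A B) (N : AlgBimodule K B C) : Module A (TensorCarrier M N) :=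
  Module.compHom _ (tensorLeftHom M N)

instance (M : AlgBimodule K A B) (N : AlgBimodule K B C) : Module Cᵐᵒᵖ (TensorCarrier M N) :=
  Module.compHom _ (tensorRightHom M N)

/-- The bimodule `M ⊗_B N`, with `a (m ⊗ n) c = (a m) ⊗ (n c)`. -/
def tensor (M : AlgBimodule K A B) (N : AlgBimodule K B C) : AlgBimodule K A C where
  carrier := TensorCarrier M N
  smulComm := ⟨fun a c x => by
    have h : tensorLeft M N a * tensorRight M N c = tensorRight M N c * tensorLeft M N a :=
      tensor_end_ext fun m n => by simp [tensorLeft_tmk, tensorRight_tmk]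
    exact LinearMap.congr_fun h x⟩
  towerLeft := ⟨fun k a x => by
    have h : tensorLeft M N (k • a) = k • tensorLeft M N a :=
      tensor_end_ext fun m n => by simp [tensorLeft_tmk, tmk_smul_left]
    exact LinearMap.congr_fun h x⟩
  towerRight := ⟨fun k c x => by
    have h : tensorRight M N (k • c) = k • tensorRight M N c :=
      tensor_end_ext fun m n => by simp [tensorRight_tmk, tmk_smul_right]
    exact LinearMap.congr_fun h x⟩

/-- Finitely generated and projective as a left module and as a right module. -/
def IsFGProjectiveOnEachSide (M : AlgBimodule K A B) : Prop :=
  Module.Finite A M ∧ Module.Projective A M ∧ Module.Finite Bᵐᵒᵖ M ∧ Module.Projective Bᵐᵒᵖ M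

end AlgBimodule

/-- `A` and `B` are stably equivalent of Morita type: there are bimodules `M` and `N`, finitely
generated projective on each side, with `M ⊗_B N ≅ A ⊕ P` and `N ⊗_A M ≅ B ⊕ Q` as bimodules,
for projective bimodules `P` and `Q`. -/
def StablyEquivalentOfMoritaType (K A B : Type u) [Field K] [Ring A] [Algebra K A]
    [Ring B] [Algebra K B] : Prop :=
  ∃ (M : AlgBimodule K A B) (N : AlgBimodule K B A),
    M.IsFGProjectiveOnEachSide ∧ N.IsFGProjectiveOnEachSide ∧
    (∃ P : AlgBimodule K A A, P.IsProjective ∧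
      Nonempty ((M.tensor N).Iso ((AlgBimodule.regular K A).directSum P))) ∧
    (∃ Q : AlgBimodule K B B, Q.IsProjective ∧
      Nonempty ((N.tensor M).Iso ((AlgBimodule.regular K B).directSum Q)))

/-! ### The algebras of type `SD(3K)` -/

namespace SD3K

/-- The vertices of the quiver `3K`. -/
inductive Vertex
  | v0 | v1 | v2

/-- The arrows of the quiver `3K`: between any two of the three vertices there is
one arrow in each direction. -/
inductive Arrow
  | β | γ | δ | η | lam | κ

open Vertex Arrow

/-- The source of an arrow. -/
def src : Arrow → Vertex
  | β => v0
  | γ => v1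
  | δ => v1
  | η => v2
  | lam => v2
  | κ => v0

/-- The target of an arrow. -/
def tgt : Arrow → Vertex
  | β => v1
  | γ => v0
  | δ => v2
  | η => v1
  | lam => v0
  | κ => v2

/-- The free algebra on the trivial paths and the arrows. -/
abbrev Free (K : Type u) [Field K] : Type u := FreeAlgebra K (Vertex ⊕ Arrow)

/-- The trivial path at a vertex, in the free algebra. -/
def e (K : Type u) [Field K] (i : Vertex) : Free K := FreeAlgebra.ι K (Sum.inl i)

/-- An arrow, in the free algebra. -/
def ar (K : Type u) [Field K] (x : Arrow) : Free K := FreeAlgebra.ι K (Sum.inr x)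

/-- The defining relations. The first five present the path algebra of the quiver `3K`, a path
being written from left to right in the order in which its arrows are passed;
the other six are the relations of `SD(3K)^{a,b,c}`. -/
inductive Rel (K : Type u) [Field K] (a b c : ℕ) : Free K → Free K → Prop
  | idem (i : Vertex) : Rel K a b c (e K i * e K i) (e K i)
  | orth (i j : Vertex) (h : i ≠ j) : Rel K a b c (e K i * e K j) 0
  | unit : Rel K a b c (e K v0 + e K v1 + e K v2) 1
  | source (x : Arrow) : Rel K a b c (e K (src x) * ar K x) (ar K x)
  | target (x : Arrow) : Rel K a b c (ar K x * e K (tgt x)) (ar K x)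
  | κη : Rel K a b c (ar K κ * ar K η) 0
  | ηγ : Rel K a b c (ar K η * ar K γ) 0
  | γκ : Rel K a b c (ar K γ * ar K κ) 0
  | δlam : Rel K a b c (ar K δ * ar K lam) ((ar K γ * ar K β) ^ (a - 1) * ar K γ)
  | βδ : Rel K a b c (ar K β * ar K δ) ((ar K κ * ar K lam) ^ (b - 1) * ar K κ)
  | lamβ : Rel K a b c (ar K lam * ar K β) ((ar K η * ar K δ) ^ (c - 1) * ar K η)

end SD3K

/-- The algebra `SD(3K)^{a,b,c}` (for `a, b, c ≥ 1`): the quotient of the path algebra over `K` of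
the quiver `3K` by the ideal generated by `κη`, `ηγ`, `γκ`, `δλ - (γβ)^{a-1}γ`,
`βδ - (κλ)^{b-1}κ` and `λβ - (ηδ)^{c-1}η`. -/
def SD3K (K : Type u) [Field K] (a b c : ℕ) : Type u := RingQuot (SD3K.Rel K a b c)

instance (K : Type u) [Field K] (a b c : ℕ) : Ring (SD3K K a b c) :=
  inferInstanceAs (Ring (RingQuot (SD3K.Rel K a b c)))

instance (K : Type u) [Field K] (a b c : ℕ) : Algebra K (SD3K K a b c) :=
  inferInstanceAs (Algebra K (RingQuot (SD3K.Rel K a b c)))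

end

/-!
Let `HH₀(A) = A / [A, A]`, a module over the centre of `A`, and let `N(A)` be the submodule spanned
by the classes of the nilpotent elements. A bimodule that is finitely generated and projective on
one side induces a transfer map on `HH₀` by the trace of a dual basis. For a projective bimodule
this map kills the classes of the nilpotent elements: on a free bimodule the trace is a multiple of
the trace of a nilpotent endomorphism of a vector space. If `N` is the common kernel of the maps
induced by the characters, which transfer maps respect, then a stable equivalence of Morita type
identifies `N(A)` with `N(B)` in such a way that an element of one centre acts on `N` like some
element of the other. Therefore the dimensions of `J ^ k • N` are invariants, where `J` is the ideal
of the central elements that act nilpotently on `N`.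

For `SD(3K)` the submodule `N` has a basis consisting of the powers of the three two-cycles with
exponents below `a`, `b` and `c`, together with one common class of their `a`-th, `b`-th and `c`-th
powers, and `J ^ k • N` is the span of the powers with exponents larger than `k`. The common class
is nonzero because it is detected by the trace of a representation by `3 × 3` matrices over a
quotient of a polynomial ring. The dimension of `J ^ k • N` is
`(a - 1 - k) + (b - 1 - k) + (c - 1 - k) + 1` (with truncated subtraction) for `k < max a b c` and
zero otherwise, from which the exponents can be read off.
-/

noncomputable section

/-! ### The filtration of a module by the powers of a radical ideal -/

lemma restrictScalars_span_eq_span_of_smul_mem {K Z V : Type*} [CommRing K] [CommRing Z]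
    [Algebra K Z] [AddCommGroup V] [Module K V] [Module Z V] [IsScalarTower K Z V] {S : Set V}
    (hS : ∀ z : Z, ∀ x ∈ S, z • x ∈ S) :
    (Submodule.span Z S).restrictScalars K = Submodule.span K S := by
  refine le_antisymm (fun x hx => ?_) (Submodule.span_le_restrictScalars K Z S)
  rw [Submodule.restrictScalars_mem] at hx
  induction hx using Submodule.span_induction with
  | mem x hx => exact Submodule.subset_span hx
  | zero => exact zero_mem _
  | add x y _ _ hx hy => exact add_mem hx hy
  | smul z x hx' hx =>
    clear hx'
    induction hx using Submodule.span_induction with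
    | mem x hx => exact Submodule.subset_span (hS z x hx)
    | zero => simp
    | add x y _ _ hx hy => simpa only [smul_add] using add_mem hx hy
    | smul k x _ hx => simpa only [smul_comm z k] using Submodule.smul_mem _ k hx

/-- The filtration `J ^ k • N` of a submodule `N`, where `J` is the ideal of the scalars that are
nilpotent on `N`. -/
def radicalFiltration {Z V : Type*} [CommRing Z] [AddCommGroup V] [Module Z V]
    (N : Submodule Z V) (k : ℕ) : Submodule Z V :=
  N.annihilator.radical ^ k • N

section RadicalFiltration

variable {Z Z' V V' : Type*} [CommRing Z] [CommRing Z'] [AddCommGroup V] [AddCommGroup V']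
  [Module Z V] [Module Z' V'] {N : Submodule Z V} {N' : Submodule Z' V'}

lemma radicalFiltration_zero : radicalFiltration N 0 = N := by
  simp [radicalFiltration]

lemma radicalFiltration_succ (k : ℕ) :
    radicalFiltration N (k + 1) = N.annihilator.radical • radicalFiltration N k := by
  rw [radicalFiltration, radicalFiltration, pow_succ', Submodule.mul_smul]

lemma mem_radical_annihilator {z : Z} :
    z ∈ N.annihilator.radical ↔ ∃ n : ℕ, ∀ h ∈ N, z ^ n • h = 0 := by
  simp only [Ideal.mem_radical_iff, Submodule.mem_annihilator]

lemma radicalFiltration_le (k : ℕ) : radicalFiltration N k ≤ N := Submodule.smul_le_right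

lemma mapsTo_radicalFiltration (s : V →+ V') (hN : s '' N = N')
    (hs : ∀ z : Z, ∃ w : Z', ∀ h ∈ N, s (z • h) = w • s h) (k : ℕ) :
    Set.MapsTo s (radicalFiltration N k) (radicalFiltration N' k) := by
  induction k with
  | zero =>
    simp only [radicalFiltration_zero]
    exact Set.mapsTo_iff_image_subset.2 hN.subset
  | succ k ih =>
    intro h hh
    rw [SetLike.mem_coe, radicalFiltration_succ] at hh ⊢
    induction hh using Submodule.smul_induction_on' with
    | smul z hz h hh =>
      obtain ⟨w, hw⟩ := hs z
      have hpow : ∀ (n : ℕ), ∀ h ∈ N, s (z ^ n • h) = w ^ n • s h := by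
        intro n
        induction n with
        | zero => simp
        | succ n ihn =>
          intro h hh
          rw [pow_succ', mul_smul, hw _ (N.smul_mem _ hh), ihn h hh, ← mul_smul, ← pow_succ']
      have hwmem : w ∈ N'.annihilator.radical := by
        obtain ⟨n, hn⟩ := mem_radical_annihilator.1 hz
        refine mem_radical_annihilator.2 ⟨n, fun h' hh' => ?_⟩
        obtain ⟨h, hh, rfl⟩ := hN.superset hh'
        rw [← hpow n h hh, hn h hh, map_zero]
      rw [hw h (radicalFiltration_le k hh)]
      exact Submodule.smul_mem_smul hwmem (ih hh)
    | add x _ y _ hx hy => simpa only [map_add] using add_mem hx hy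

lemma finrank_radicalFiltration_le {K : Type*} [Field K] [Algebra K Z] [Algebra K Z'] [Module K V]
    [Module K V'] [IsScalarTower K Z V] [IsScalarTower K Z' V'] [Module.Finite K V']
    (s : V →ₗ[K] V') (hN : Set.BijOn s N N')
    (hs : ∀ z : Z, ∃ w : Z', ∀ h ∈ N, s (z • h) = w • s h) (k : ℕ) :
    Module.finrank K (radicalFiltration N k) ≤ Module.finrank K (radicalFiltration N' k) := by
  have hmaps := mapsTo_radicalFiltration s.toAddMonoidHom hN.image_eq hs k
  let f := s.restrict (p := (radicalFiltration N k).restrictScalars K)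
    (q := (radicalFiltration N' k).restrictScalars K) hmaps
  have : Module.Finite K (radicalFiltration N' k) :=
    FiniteDimensional.finiteDimensional_submodule ((radicalFiltration N' k).restrictScalars K)
  refine LinearMap.finrank_le_finrank_of_injective (f := f) fun x y hxy => Subtype.ext ?_
  exact hN.injOn (radicalFiltration_le k x.2) (radicalFiltration_le k y.2)
    (congrArg Subtype.val hxy)

end RadicalFiltration

/-! ### The zeroth Hochschild homology and traces -/

/-- The span `[A, A]` of the commutators of an algebra, as a module over the centre. -/
def commutatorSpan (K A : Type*) [CommRing K] [Ring A] [Algebra K A] :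
    Submodule (Subalgebra.center K A) A :=
  Submodule.span _ {x | ∃ u v : A, x = u * v - v * u}

/-- The zeroth Hochschild homology `A / [A, A]`, as a module over the centre. -/
def HochschildZero (K A : Type*) [CommRing K] [Ring A] [Algebra K A] : Type _ :=
  A ⧸ commutatorSpan K A

namespace HochschildZero

section

variable (K A : Type*) [CommRing K] [Ring A] [Algebra K A]

instance : AddCommGroup (HochschildZero K A) :=
  inferInstanceAs (AddCommGroup (A ⧸ commutatorSpan K A))

instance : Module K (HochschildZero K A) :=
  inferInstanceAs (Module K (A ⧸ commutatorSpan K A))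

instance : Module (Subalgebra.center K A) (HochschildZero K A) :=
  inferInstanceAs (Module (Subalgebra.center K A) (A ⧸ commutatorSpan K A))

instance : IsScalarTower K (Subalgebra.center K A) (HochschildZero K A) :=
  inferInstanceAs (IsScalarTower K (Subalgebra.center K A) (A ⧸ commutatorSpan K A))

end

section

variable (K : Type*) {A : Type*} [CommRing K] [Ring A] [Algebra K A]

/-- The class of an element modulo commutators. -/
def cl : A →ₗ[K] HochschildZero K A where
  toFun := (commutatorSpan K A).mkQ
  map_add' _ _ := rfl
  map_smul' _ _ := rfl

lemma cl_mul_comm (u v : A) : cl K (u * v) = cl K (v * u) :=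
  (Submodule.Quotient.eq (commutatorSpan K A)).2 (Submodule.subset_span ⟨u, v, rfl⟩)

lemma cl_surjective : Function.Surjective (cl K : A → HochschildZero K A) :=
  (commutatorSpan K A).mkQ_surjective

instance [Module.Finite K A] : Module.Finite K (HochschildZero K A) :=
  Module.Finite.of_surjective (cl K) (cl_surjective K)

lemma center_smul_cl (z : Subalgebra.center K A) (x : A) : z • cl K x = cl K ((z : A) * x) := rfl

variable {K}

lemma restrictScalars_commutatorSpan :
    (commutatorSpan K A).restrictScalars K =
      Submodule.span K {x | ∃ u v : A, x = u * v - v * u} := by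
  refine restrictScalars_span_eq_span_of_smul_mem ?_
  rintro z _ ⟨u, v, rfl⟩
  have hz := Subalgebra.mem_center_iff.1 z.2 v
  exact ⟨z • u, v, by simp only [Subalgebra.smul_def, smul_eq_mul, mul_sub, ← mul_assoc, hz]⟩

/-- A linear map with `f (u * v) = f (v * u)` descends to `A / [A, A]`. -/
def lift {V : Type*} [AddCommGroup V] [Module K V] (f : A →ₗ[K] V)
    (hf : ∀ u v, f (u * v) = f (v * u)) : HochschildZero K A →ₗ[K] V :=
  ((commutatorSpan K A).restrictScalars K).liftQ f (by
      rw [restrictScalars_commutatorSpan, Submodule.span_le]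
      rintro _ ⟨u, v, rfl⟩
      simp [hf u v]) ∘ₗ
    (Submodule.Quotient.restrictScalarsEquiv K (commutatorSpan K A)).symm.toLinearMap

@[simp]
lemma lift_cl {V : Type*} [AddCommGroup V] [Module K V] (f : A →ₗ[K] V)
    (hf : ∀ u v, f (u * v) = f (v * u)) (x : A) : lift f hf (cl K x) = f x := rfl

/-- The map to `K` induced by a character. -/
def char (χ : A →ₐ[K] K) : HochschildZero K A →ₗ[K] K :=
  lift χ.toLinearMap fun u v => by simp [mul_comm]

@[simp]
lemma char_cl (χ : A →ₐ[K] K) (x : A) : char χ (cl K x) = χ x := rfl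

variable (K A) in
/-- The span of the classes of the nilpotent elements. -/
def nilpotentClasses : Submodule (Subalgebra.center K A) (HochschildZero K A) :=
  Submodule.span _ (cl K '' {x | IsNilpotent x})

lemma cl_mem_nilpotentClasses {x : A} (hx : IsNilpotent x) : cl K x ∈ nilpotentClasses K A :=
  Submodule.subset_span ⟨x, hx, rfl⟩

lemma restrictScalars_nilpotentClasses :
    (nilpotentClasses K A).restrictScalars K =
      Submodule.span K (cl K '' {x : A | IsNilpotent x}) := by
  refine restrictScalars_span_eq_span_of_smul_mem ?_
  rintro z _ ⟨x, ⟨n, hn⟩, rfl⟩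
  have hz : Commute (z : A) x := (Subalgebra.mem_center_iff.1 z.2 x).symm
  exact ⟨z * x, ⟨n, by rw [hz.mul_pow, hn, mul_zero]⟩, rfl⟩

lemma eq_on_nilpotentClasses {V : Type*} [AddCommGroup V] [Module K V]
    {f g : HochschildZero K A →ₗ[K] V} (hfg : ∀ x : A, IsNilpotent x → f (cl K x) = g (cl K x)) :
    Set.EqOn f g (nilpotentClasses K A) := by
  intro h hh
  rw [SetLike.mem_coe, ← Submodule.restrictScalars_mem K, restrictScalars_nilpotentClasses] at hh
  exact LinearMap.eqOn_span (by rintro _ ⟨x, hx, rfl⟩; exact hfg x hx) hh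

lemma char_eq_zero_of_mem_nilpotentClasses [IsReduced K] (χ : A →ₐ[K] K) {h : HochschildZero K A}
    (hh : h ∈ nilpotentClasses K A) : char χ h = 0 :=
  eq_on_nilpotentClasses (f := char χ) (g := 0) (fun _ hx => (hx.map χ).eq_zero) hh

end

end HochschildZero

open HochschildZero

/-- A finite dual basis of a (finitely generated projective) module. -/
structure FiniteDualBasis (A X : Type*) [Ring A] [AddCommGroup X] [Module A X] where
  ι : Type
  [fintype : Fintype ι]
  vec : ι → X
  coord : ι → X →ₗ[A] A
  sum_coord : ∀ x, ∑ i, coord i x • vec i = x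

namespace FiniteDualBasis

attribute [instance] fintype

section

variable {A E X : Type*} [Ring A] [Ring E] [AddCommGroup X] [Module A X] [Module E X]

lemma nonempty_of_projective [Module.Finite A X] [Module.Projective A X] :
    Nonempty (FiniteDualBasis A X) := by
  classical
  obtain ⟨n, f, g, -, -, hfg⟩ := Module.Finite.exists_comp_eq_id_of_projective A X
  refine ⟨⟨Fin n, fun i => f (Pi.single i 1), fun i => LinearMap.proj i ∘ₗ g, fun x => ?_⟩⟩
  simp only [LinearMap.comp_apply, LinearMap.proj_apply, ← map_smul, ← map_sum,
    ← pi_eq_sum_univ' (g x)]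
  exact LinearMap.congr_fun hfg x

variable (A) in
/-- The dual basis `1` of the regular module. -/
def self : FiniteDualBasis A A where
  ι := Unit
  vec := fun _ => 1
  coord := fun _ => LinearMap.id
  sum_coord := by simp

/-- A basis with its coordinate functions. -/
def ofBasis {ι : Type} [Fintype ι] (y : Module.Basis ι A X) : FiniteDualBasis A X where
  ι := ι
  vec := y
  coord := y.coord
  sum_coord := y.sum_repr

/-- The dual basis `(e_l x_k)` over `A` obtained from dual bases `(x_k)` over `E` and `(e_l)` of `E`
over `A`. -/
def trans [Module A E] [IsScalarTower A E E] [IsScalarTower A E X] (D : FiniteDualBasis E X)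
    (Y : FiniteDualBasis A E) : FiniteDualBasis A X where
  ι := D.ι × Y.ι
  vec i := Y.vec i.2 • D.vec i.1
  coord i := Y.coord i.2 ∘ₗ (D.coord i.1).restrictScalars A
  sum_coord x := by
    simp only [LinearMap.comp_apply, LinearMap.coe_restrictScalars, ← smul_assoc,
      Fintype.sum_prod_type, ← Finset.sum_smul, Y.sum_coord, D.sum_coord]

end

section Trace

variable (K : Type*) {A X Y Q : Type*} [CommRing K] [Ring A] [Algebra K A]
  [AddCommGroup X] [Module K X] [Module A X] [IsScalarTower K A X]
  [AddCommGroup Y] [Module K Y] [Module A Y] [IsScalarTower K A Y]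
  [AddCommGroup Q] [Module K Q] [Module A Q] [IsScalarTower K A Q]

/-- The Hattori–Stallings trace of an endomorphism. -/
def trace (D : FiniteDualBasis A X) : (X →ₗ[A] X) →ₗ[K] HochschildZero K A :=
  ∑ i, cl K ∘ₗ (D.coord i).restrictScalars K ∘ₗ LinearMap.applyₗ' K (D.vec i)

lemma trace_apply (D : FiniteDualBasis A X) (f : X →ₗ[A] X) :
    D.trace K f = ∑ i, cl K (D.coord i (f (D.vec i))) := by
  simp [trace]

lemma trace_self (f : A →ₗ[A] A) : (self A).trace K f = cl K (f 1) :=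
  (trace_apply K (self A) f).trans (Fintype.sum_unique (ι := Unit) _)

lemma trace_comp_comm (D : FiniteDualBasis A X) (E : FiniteDualBasis A Y)
    (f : X →ₗ[A] Y) (g : Y →ₗ[A] X) : D.trace K (g ∘ₗ f) = E.trace K (f ∘ₗ g) := by
  have hgf (i : D.ι) : D.coord i (g (f (D.vec i))) =
      ∑ j, E.coord j (f (D.vec i)) * D.coord i (g (E.vec j)) := by
    conv_lhs => rw [← E.sum_coord (f (D.vec i))]
    simp
  have hfg (j : E.ι) : E.coord j (f (g (E.vec j))) =
      ∑ i, D.coord i (g (E.vec j)) * E.coord j (f (D.vec i)) := by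
    conv_lhs => rw [← D.sum_coord (g (E.vec j))]
    simp
  simp only [trace_apply, LinearMap.comp_apply, hgf, hfg, map_sum]
  rw [Finset.sum_comm]
  simp only [cl_mul_comm]

lemma trace_eq_add (D : FiniteDualBasis A X) (E : FiniteDualBasis A Y) (F : FiniteDualBasis A Q)
    (θ : X ≃ₗ[A] Y × Q) (f : X →ₗ[A] X) :
    D.trace K f =
      E.trace K ((LinearMap.fst A Y Q ∘ₗ θ.toLinearMap) ∘ₗ f ∘ₗ
        θ.symm.toLinearMap ∘ₗ LinearMap.inl A Y Q) +
      F.trace K ((LinearMap.snd A Y Q ∘ₗ θ.toLinearMap) ∘ₗ f ∘ₗ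
        θ.symm.toLinearMap ∘ₗ LinearMap.inr A Y Q) := by
  rw [← trace_comp_comm K D E, ← trace_comp_comm K D F, ← map_add]
  congr 1
  ext x
  simp [← map_add]

lemma trace_trans {E : Type*} [Ring E] [Algebra K E] [Module A E] [IsScalarTower K A E]
    [IsScalarTower A E E] [Module E X] [IsScalarTower A E X]
    (D : FiniteDualBasis E X) (Y : FiniteDualBasis A E) (f : X →ₗ[A] X) :
    (D.trans Y).trace K f = ∑ k, Y.trace K ((D.coord k).restrictScalars A ∘ₗ f ∘ₗ
      (LinearMap.toSpanSingleton E X (D.vec k)).restrictScalars A) := by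
  simp only [trace_apply]
  exact Fintype.sum_prod_type _

lemma char_trace_eq_zero_of_isNilpotent [IsReduced K] (D : FiniteDualBasis A X) (χ : A →ₐ[K] K)
    {f : Module.End A X} (hf : IsNilpotent f) : char χ (D.trace K f) = 0 := by
  classical
  let mat (f : Module.End A X) : Matrix D.ι D.ι K :=
    Matrix.of fun k j => χ (D.coord j (f (D.vec k)))
  have mat_mul (f g : Module.End A X) : mat f * mat g = mat (g * f) := by
    ext k l
    simp only [mat, Matrix.mul_apply, Matrix.of_apply, ← map_mul, ← map_sum, Module.End.mul_apply]
    conv_rhs => rw [← D.sum_coord (f (D.vec k))]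
    simp only [map_sum, map_smul, smul_eq_mul]
  have mat_pow (n : ℕ) : mat f ^ (n + 1) = mat (f ^ (n + 1)) := by
    induction n with
    | zero => simp
    | succ n ih => rw [pow_succ, ih, mat_mul, ← pow_succ']
  have hmat : IsNilpotent (mat f) := by
    obtain ⟨n, hn⟩ := hf
    refine ⟨n + 1, ?_⟩
    rw [mat_pow, pow_succ, hn, zero_mul]
    ext k j
    simp [mat]
  simpa [trace_apply, mat, Matrix.trace] using
    (Matrix.isNilpotent_trace_of_isNilpotent hmat).eq_zero

end Trace

end FiniteDualBasis

/-! ### Transfer along bimodules -/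

lemma isNilpotent_op {R : Type*} [MonoidWithZero R] {x : R} (hx : IsNilpotent x) :
    IsNilpotent (MulOpposite.op x) := by
  obtain ⟨n, hn⟩ := hx
  exact ⟨n, by rw [← MulOpposite.op_pow, hn, MulOpposite.op_zero]⟩

namespace AlgBimodule

variable {K A B C : Type u} [Field K] [Ring A] [Algebra K A] [Ring B] [Algebra K B]
  [Ring C] [Algebra K C]

instance (M : AlgBimodule K A B) : SMulCommClass Bᵐᵒᵖ A M := SMulCommClass.symm _ _ _

/-- Right multiplication, by endomorphisms of the left module. -/
def rmul (M : AlgBimodule K A B) : Bᵐᵒᵖ →ₐ[K] Module.End A M := Algebra.lsmul K A M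

@[simp]
lemma rmul_apply (M : AlgBimodule K A B) (b : Bᵐᵒᵖ) (m : M) : M.rmul b m = b • m := rfl

/-- Left multiplication by a central element, as an endomorphism of the left module. -/
def lmul (M : AlgBimodule K A B) (z : Subalgebra.center K A) : Module.End A M where
  toFun m := (z : A) • m
  map_add' := smul_add _
  map_smul' a m := by
    simp only [smul_smul, RingHom.id_apply, Subalgebra.mem_center_iff.1 z.2 a]

@[simp]
lemma lmul_apply (M : AlgBimodule K A B) (z : Subalgebra.center K A) (m : M) :
    M.lmul z m = (z : A) • m := rfl

lemma lmul_one (M : AlgBimodule K A B) : M.lmul 1 = 1 := by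
  ext m
  simp

lemma commute_lmul_rmul (M : AlgBimodule K A B) (z : Subalgebra.center K A) (b : Bᵐᵒᵖ) :
    Commute (M.lmul z) (M.rmul b) :=
  LinearMap.ext fun m => smul_comm (z : A) b m

/-- The transfer `B / [B, B] → A / [A, A]` along an `A`-`B`-bimodule, which sends the class of `b`
to the Hattori–Stallings trace of right multiplication by `b`. -/
def transfer (M : AlgBimodule K A B) (D : FiniteDualBasis A M) :
    HochschildZero K B →ₗ[K] HochschildZero K A :=
  HochschildZero.lift
    (D.trace K ∘ₗ M.rmul.toLinearMap ∘ₗ (MulOpposite.opLinearEquiv K).toLinearMap) fun u v => by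
      simpa [Module.End.mul_eq_comp] using FiniteDualBasis.trace_comp_comm K D D _ _

lemma transfer_cl (M : AlgBimodule K A B) (D : FiniteDualBasis A M) (b : B) :
    M.transfer D (cl K b) = D.trace K (M.rmul (MulOpposite.op b)) := rfl

lemma center_smul_transfer_cl (M : AlgBimodule K A B) (D : FiniteDualBasis A M)
    (z : Subalgebra.center K A) (b : B) :
    z • M.transfer D (cl K b) = D.trace K (M.lmul z * M.rmul (MulOpposite.op b)) := by
  simp [transfer_cl, FiniteDualBasis.trace_apply, Finset.smul_sum, center_smul_cl]

lemma char_transfer_of_mem_nilpotentClasses (M : AlgBimodule K A B) (D : FiniteDualBasis A M)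
    (χ : A →ₐ[K] K) {h : HochschildZero K B} (hh : h ∈ nilpotentClasses K B) :
    char χ (M.transfer D h) = 0 := by
  refine eq_on_nilpotentClasses (f := char χ ∘ₗ M.transfer D) (g := 0) (fun b hb => ?_) hh
  exact D.char_trace_eq_zero_of_isNilpotent K χ ((isNilpotent_op hb).map M.rmul)

/-- An isomorphism onto a direct sum, as an isomorphism of left modules. -/
def Iso.toProdEquiv {X Y Q : AlgBimodule K A B} (θ : X.Iso (Y.directSum Q)) : X ≃ₗ[A] Y × Q :=
  { θ.toLinearEquiv with map_smul' := θ.map_left }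

lemma Iso.toProdEquiv_op_smul {X Y Q : AlgBimodule K A B} (θ : X.Iso (Y.directSum Q)) (b : Bᵐᵒᵖ)
    (x : X) : θ.toProdEquiv (b • x) = b • θ.toProdEquiv x := θ.map_right b x

lemma Iso.toProdEquiv_symm_op_smul {X Y Q : AlgBimodule K A B} (θ : X.Iso (Y.directSum Q))
    (b : Bᵐᵒᵖ) (x : Y × Q) : θ.toProdEquiv.symm (b • x) = b • θ.toProdEquiv.symm x := by
  rw [LinearEquiv.symm_apply_eq, toProdEquiv_op_smul, LinearEquiv.apply_symm_apply]

section Tensor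

variable (M : AlgBimodule K A B) (N : AlgBimodule K B C)

/-- The canonical bilinear map to the bimodule `M ⊗_B N`. -/
def tens : M →ₗ[K] N →ₗ[K] M.tensor N :=
  LinearMap.mk₂ K (tmk M N) (tmk_add_left M N) (tmk_smul_left M N) (tmk_add_right M N)
    (tmk_smul_right M N)

variable {M N}

lemma smul_tens (a : A) (m : M) (n : N) : a • tens M N m n = tens M N (a • m) n := rfl

lemma tens_balanced (m : M) (b : B) (n : N) :
    tens M N (MulOpposite.op b • m) n = tens M N m (b • n) :=
  (Submodule.Quotient.eq (balancing M N)).2 (Submodule.subset_span ⟨m, b, n, rfl⟩)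

lemma tensor_induction {motive : M.tensor N → Prop} (zero : motive 0)
    (tens : ∀ m n, motive (tens M N m n))
    (add : ∀ x y, motive x → motive y → motive (x + y)) (x : M.tensor N) : motive x := by
  obtain ⟨t, rfl⟩ := (balancing M N).mkQ_surjective x
  induction t using TensorProduct.induction_on with
  | zero => exact zero
  | tmul m n => exact tens m n
  | add x y hx hy => exact add _ _ hx hy

lemma finite_tensor [Module.Finite K M] [Module.Finite K N] : Module.Finite K (M.tensor N) :=
  inferInstanceAs (Module.Finite K ((M ⊗[K] N) ⧸ balancing M N))

/-- The morphism `m ⊗ n ↦ φ m n` of left modules on `M ⊗_B N` given by a balanced map `φ`. -/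
def tensorLift {V : Type*} [AddCommGroup V] [Module K V] [Module A V] (φ : M →ₗ[K] N →ₗ[K] V)
    (hbal : ∀ m (b : B) n, φ (MulOpposite.op b • m) n = φ m (b • n))
    (hlin : ∀ (a : A) m n, φ (a • m) n = a • φ m n) : M.tensor N →ₗ[A] V :=
  let g : M.tensor N →ₗ[K] V :=
    (balancing M N).liftQ (TensorProduct.lift φ) <| Submodule.span_le.2 <| by
      rintro _ ⟨m, b, n, rfl⟩
      simp [hbal]
  { g with
    map_smul' := fun a x => by
      change g (a • x) = a • g x
      induction x using tensor_induction with
      | zero => simp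
      | tens m n => exact hlin a m n
      | add x y hx hy => simp only [smul_add, map_add, hx, hy] }

@[simp]
lemma tensorLift_tens {V : Type*} [AddCommGroup V] [Module K V] [Module A V]
    (φ : M →ₗ[K] N →ₗ[K] V) (hbal) (hlin) (m : M) (n : N) :
    tensorLift (A := A) φ hbal hlin (tens M N m n) = φ m n := rfl

lemma tensor_hom_ext {V : Type*} [AddCommGroup V] [Module A V] {f g : M.tensor N →ₗ[A] V}
    (h : ∀ m n, f (tens M N m n) = g (tens M N m n)) : f = g := by
  ext x
  induction x using tensor_induction with
  | zero => simp
  | tens m n => exact h m n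
  | add x y hx hy => simp only [map_add, hx, hy]

/-- The endomorphism `m ⊗ n ↦ m ⊗ g n` of `M ⊗_B N`. -/
def tensorMapRight : Module.End B N →* Module.End A (M.tensor N) where
  toFun g := tensorLift ((tens M N).compl₂ (g.restrictScalars K))
    (fun m b n => by simp [tens_balanced]) (fun a m n => by simp [smul_tens])
  map_one' := tensor_hom_ext fun _ _ => rfl
  map_mul' f g := tensor_hom_ext fun _ _ => rfl

lemma tensorMapRight_rmul (c : Cᵐᵒᵖ) :
    tensorMapRight (N.rmul c) = (M.tensor N).rmul c :=
  tensor_hom_ext fun _ _ => rfl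

/-- The dual basis of `M ⊗_B N` obtained from dual bases of `M` and `N`. -/
def tensorDualBasis (D : FiniteDualBasis A M) (E : FiniteDualBasis B N) :
    FiniteDualBasis A (M.tensor N) where
  ι := E.ι × D.ι
  vec ij := tens M N (D.vec ij.2) (E.vec ij.1)
  coord ij := tensorLift
    (LinearMap.mk₂ K (fun m n => D.coord ij.2 (MulOpposite.op (E.coord ij.1 n) • m))
      (fun m m' n => by simp)
      (fun k m n => by rw [smul_comm, (D.coord ij.2).map_smul_of_tower])
      (fun m n n' => by simp [add_smul])
      (fun k m n => by
        rw [(E.coord ij.1).map_smul_of_tower, MulOpposite.op_smul, smul_assoc,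
          (D.coord ij.2).map_smul_of_tower]))
    (fun m b n => by simp [smul_smul])
    (fun a m n => by
      rw [LinearMap.mk₂_apply, LinearMap.mk₂_apply, ← smul_comm a, map_smul])
  sum_coord x := by
    induction x using tensor_induction with
    | zero => simp
    | tens m n =>
      simp only [tensorLift_tens, LinearMap.mk₂_apply, Fintype.sum_prod_type, smul_tens]
      simp only [← LinearMap.sum_apply, ← map_sum, D.sum_coord, tens_balanced, E.sum_coord]
    | add x y hx hy => simp only [map_add, add_smul, Finset.sum_add_distrib, hx, hy]

lemma transfer_trace (D : FiniteDualBasis A M) (E : FiniteDualBasis B N) (g : Module.End B N) :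
    M.transfer D (E.trace K g) = (tensorDualBasis D E).trace K (tensorMapRight g) := by
  simp only [FiniteDualBasis.trace_apply, map_sum, transfer_cl]
  exact (Fintype.sum_prod_type fun ij : E.ι × D.ι => cl K (D.coord ij.2
    (MulOpposite.op (E.coord ij.1 (g (E.vec ij.1))) • D.vec ij.2))).symm

end Tensor

section Projective

lemma trace_ofBasis_eq_zero_of_isNilpotent {K A S : Type*} {κ : Type} [Field K] [Ring A]
    [Algebra K A] [Ring S] [Algebra K S] [Fintype κ] (y : Module.Basis κ K S) {s : S}
    (hs : IsNilpotent s) (t : A ⊗[K] S) (f : A ⊗[K] S →ₗ[A] A ⊗[K] S)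
    (hf : ∀ x, f x = (1 ⊗ₜ s) * x * t) :
    (FiniteDualBasis.ofBasis (Algebra.TensorProduct.basis A y)).trace K f = 0 := by
  classical
  simp only [FiniteDualBasis.trace_apply, hf]
  clear hf
  dsimp only [FiniteDualBasis.ofBasis]
  simp only [Algebra.TensorProduct.basis_apply, Algebra.TensorProduct.tmul_mul_tmul, one_mul]
  induction t using TensorProduct.induction_on with
  | zero => simp
  | add t t' ht ht' => simp only [mul_add, map_add, Finset.sum_add_distrib, ht, ht', add_zero]
  | tmul a v =>
    have htr : ∑ l, y.repr (s * y l * v) l = 0 := by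
      have hcomm : Commute (LinearMap.mulLeft K s) (LinearMap.mulRight K v) :=
        LinearMap.ext fun x => (mul_assoc s x v).symm
      have hnil : IsNilpotent (LinearMap.mulRight K v * LinearMap.mulLeft K s) :=
        hcomm.symm.isNilpotent_mul_left ((LinearMap.isNilpotent_mulLeft_iff K s).2 hs)
      have := (LinearMap.isNilpotent_trace_of_isNilpotent hnil).eq_zero
      rw [LinearMap.trace_eq_matrix_trace K y] at this
      simpa [Matrix.trace, LinearMap.toMatrix_apply] using this
    calc _ = ∑ l, y.repr (s * y l * v) l • cl K a := by
          refine Finset.sum_congr rfl fun l _ => ?_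
          simp [Algebra.TensorProduct.basis_repr_tmul, ← map_smul, Algebra.smul_def,
            Algebra.commutes]
      _ = 0 := by rw [← Finset.sum_smul, htr, zero_smul]

variable {K A B : Type u} [Field K] [Ring A] [Algebra K A] [Ring B] [Algebra K B]

instance (Q : AlgBimodule K A B) : Module (A ⊗[K] Bᵐᵒᵖ) Q := TensorProduct.Algebra.module

lemma tmul_smul_def (Q : AlgBimodule K A B) (a : A) (b : Bᵐᵒᵖ) (q : Q) :
    (a ⊗ₜ[K] b) • q = a • b • q := rfl

instance (Q : AlgBimodule K A B) : IsScalarTower A (A ⊗[K] Bᵐᵒᵖ) Q where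
  smul_assoc a t q := by
    induction t using TensorProduct.induction_on with
    | zero => rw [smul_zero, zero_smul (A ⊗[K] Bᵐᵒᵖ) q, smul_zero]
    | tmul a' b => simp only [TensorProduct.smul_tmul', tmul_smul_def, smul_eq_mul, mul_smul]
    | add t t' ht ht' => simp only [smul_add, add_smul, ht, ht']

instance (Q : AlgBimodule K A B) : IsScalarTower K (A ⊗[K] Bᵐᵒᵖ) Q where
  smul_assoc k t q := by
    rw [← algebraMap_smul A k t, smul_assoc, algebraMap_smul]

lemma map_tensor_smul {Q : AlgBimodule K A B} {f : Module.End A Q}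
    (hf : ∀ b, Commute f (Q.rmul b)) (t : A ⊗[K] Bᵐᵒᵖ) (q : Q) : f (t • q) = t • f q := by
  induction t using TensorProduct.induction_on with
  | zero => rw [zero_smul (A ⊗[K] Bᵐᵒᵖ) q, zero_smul (A ⊗[K] Bᵐᵒᵖ) (f q), map_zero]
  | tmul a b =>
    rw [tmul_smul_def, tmul_smul_def, map_smul]
    exact congrArg (a • ·) (LinearMap.congr_fun (hf b) q)
  | add t t' ht ht' => simp only [add_smul, map_add, ht, ht']

lemma IsProjective.exists_trace_mul_rmul_eq_zero {Q : AlgBimodule K A B} (hQ : Q.IsProjective)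
    [Module.Finite K B] [Module.Finite K Q] :
    ∃ F : FiniteDualBasis A Q, ∀ f : Module.End A Q, (∀ b, Commute f (Q.rmul b)) →
      ∀ b : B, IsNilpotent b → F.trace K (f * Q.rmul (MulOpposite.op b)) = 0 := by
  have : Module.Projective (A ⊗[K] Bᵐᵒᵖ) Q := hQ
  have : Module.Finite (A ⊗[K] Bᵐᵒᵖ) Q := Module.Finite.of_restrictScalars_finite K _ _
  obtain ⟨D⟩ := FiniteDualBasis.nonempty_of_projective (A := A ⊗[K] Bᵐᵒᵖ) (X := Q)
  let y := Module.finBasis K Bᵐᵒᵖ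
  refine ⟨D.trans (.ofBasis (Algebra.TensorProduct.basis A y)), fun f hf b hb => ?_⟩
  have hb' (q : Q) : MulOpposite.op b • q = (1 ⊗ₜ[K] MulOpposite.op b : A ⊗[K] Bᵐᵒᵖ) • q := by
    rw [tmul_smul_def, one_smul]
  refine (D.trace_trans K _ _).trans (Finset.sum_eq_zero fun k _ =>
    trace_ofBasis_eq_zero_of_isNilpotent y (isNilpotent_op hb) (D.coord k (f (D.vec k))) _
      fun t => ?_)
  calc D.coord k (f (MulOpposite.op b • t • D.vec k))
      = D.coord k (((1 ⊗ₜ MulOpposite.op b) * t) • f (D.vec k)) := by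
        rw [hb', ← mul_smul, map_tensor_smul hf]
    _ = _ := by rw [map_smul, smul_eq_mul]

end Projective

section Stable

variable {K A B : Type u} [Field K] [Ring A] [Algebra K A] [Ring B] [Algebra K B]

lemma Iso.exists_trace_mul_rmul_eq_add {X Y Q : AlgBimodule K A B} (θ : X.Iso (Y.directSum Q))
    (D : FiniteDualBasis A X) (E : FiniteDualBasis A Y) (F : FiniteDualBasis A Q)
    {g : Module.End A X} (hg : ∀ b, Commute g (X.rmul b)) :
    ∃ (φ : Module.End A Y) (ψ : Module.End A Q), (g = 1 → φ = 1) ∧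
      (∀ b, Commute φ (Y.rmul b)) ∧ (∀ b, Commute ψ (Q.rmul b)) ∧
      ∀ b, D.trace K (g * X.rmul b) = E.trace K (φ * Y.rmul b) + F.trace K (ψ * Q.rmul b) := by
  let p : X →ₗ[A] Y := LinearMap.fst A Y Q ∘ₗ θ.toProdEquiv.toLinearMap
  let i : Y →ₗ[A] X := θ.toProdEquiv.symm.toLinearMap ∘ₗ LinearMap.inl A Y Q
  let r : X →ₗ[A] Q := LinearMap.snd A Y Q ∘ₗ θ.toProdEquiv.toLinearMap
  let j : Q →ₗ[A] X := θ.toProdEquiv.symm.toLinearMap ∘ₗ LinearMap.inr A Y Q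
  have hg' (b : Bᵐᵒᵖ) (x : X) : g (b • x) = b • g x := LinearMap.congr_fun (hg b) x
  have hp (b : Bᵐᵒᵖ) (x : X) : p (b • x) = b • p x :=
    congrArg Prod.fst (θ.toProdEquiv_op_smul b x)
  have hr (b : Bᵐᵒᵖ) (x : X) : r (b • x) = b • r x :=
    congrArg Prod.snd (θ.toProdEquiv_op_smul b x)
  have hi (b : Bᵐᵒᵖ) (y : Y) : i (b • y) = b • i y := by
    simp [i, ← Iso.toProdEquiv_symm_op_smul]
  have hj (b : Bᵐᵒᵖ) (q : Q) : j (b • q) = b • j q := by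
    simp [j, ← Iso.toProdEquiv_symm_op_smul]
  refine ⟨p ∘ₗ g ∘ₗ i, r ∘ₗ g ∘ₗ j, ?_, fun b => ?_, fun b => ?_, fun b => ?_⟩
  · rintro rfl
    ext y
    simp [p, i]
  · ext y
    simp [hi, hg', hp]
  · ext q
    simp [hj, hg', hr]
  · rw [D.trace_eq_add K E F θ.toProdEquiv]
    congr 2
    · ext y
      simpa [p, i] using congrArg (p ∘ g) (hi b y).symm
    · ext q
      simpa [r, j] using congrArg (r ∘ g) (hj b q).symm

lemma apply_one_mem_center {φ : A →ₗ[A] A} (hφ : ∀ x a, φ (x * a) = φ x * a) :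
    φ 1 ∈ Subalgebra.center K A := by
  refine Subalgebra.mem_center_iff.2 fun a => ?_
  rw [← smul_eq_mul, ← map_smul, smul_eq_mul, mul_one, ← hφ, one_mul]

lemma Iso.exists_center_trace_eq_smul_cl {X Q : AlgBimodule K A A}
    (θ : X.Iso ((regular K A).directSum Q)) (hQ : Q.IsProjective) [Module.Finite K A]
    [Module.Finite K X] (D : FiniteDualBasis A X) {g : Module.End A X}
    (hg : ∀ a, Commute g (X.rmul a)) :
    ∃ w : Subalgebra.center K A, (g = 1 → w = 1) ∧
      ∀ x : A, IsNilpotent x → D.trace K (g * X.rmul (MulOpposite.op x)) = w • cl K x := by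
  have : Module.Finite K Q := Module.Finite.of_surjective
    (LinearMap.snd K A Q ∘ₗ θ.toLinearMap) (Prod.snd_surjective.comp θ.surjective)
  obtain ⟨F, hF⟩ := hQ.exists_trace_mul_rmul_eq_zero
  obtain ⟨φ, ψ, hφ₁, hφ, hψ, htrace⟩ := θ.exists_trace_mul_rmul_eq_add D (.self A) F hg
  let φ' : A →ₗ[A] A := φ
  have hmul (x a : A) : φ' (x * a) = φ' x * a := LinearMap.congr_fun (hφ (MulOpposite.op a)) x
  refine ⟨⟨φ' 1, apply_one_mem_center hmul⟩,
    fun hg₁ => Subtype.ext (LinearMap.congr_fun (hφ₁ hg₁) (1 : A)), fun x hx => ?_⟩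
  rw [htrace, hF ψ hψ x hx, add_zero, center_smul_cl, ← hmul]
  exact FiniteDualBasis.trace_self K (φ * (regular K A).rmul (MulOpposite.op x))

lemma exists_center_transfer_smul_transfer [Module.Finite K A] {M : AlgBimodule K A B}
    {N : AlgBimodule K B A} [Module.Finite K M] [Module.Finite K N] (D : FiniteDualBasis A M)
    (E : FiniteDualBasis B N) {P : AlgBimodule K A A} (hP : P.IsProjective)
    (θ : (M.tensor N).Iso ((regular K A).directSum P)) (z : Subalgebra.center K B) :
    ∃ w : Subalgebra.center K A, (z = 1 → w = 1) ∧
      ∀ h ∈ nilpotentClasses K A, M.transfer D (z • N.transfer E h) = w • h := by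
  have := finite_tensor (M := M) (N := N)
  have hcomm (a : Aᵐᵒᵖ) :
      Commute (tensorMapRight (M := M) (N.lmul z)) ((M.tensor N).rmul a) := by
    rw [← tensorMapRight_rmul]
    exact (N.commute_lmul_rmul z a).map tensorMapRight
  obtain ⟨w, hw₁, hw⟩ := θ.exists_center_trace_eq_smul_cl hP (tensorDualBasis D E) hcomm
  refine ⟨w, fun hz => hw₁ (by rw [hz, lmul_one, map_one]), ?_⟩
  refine eq_on_nilpotentClasses (g := Algebra.lsmul K K _ w)
    (f := M.transfer D ∘ₗ Algebra.lsmul K K _ z ∘ₗ N.transfer E) fun x hx => ?_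
  change M.transfer D (z • N.transfer E (cl K x)) = w • cl K x
  rw [center_smul_transfer_cl, transfer_trace, map_mul, tensorMapRight_rmul, hw x hx]

end Stable

section Regular

variable {K A B : Type u} [Field K] [Ring A] [Algebra K A] [Ring B] [Algebra K B]

lemma isFGProjectiveOnEachSide_regular : (regular K A).IsFGProjectiveOnEachSide := by
  let e : Aᵐᵒᵖ ≃ₗ[Aᵐᵒᵖ] A :=
    { (MulOpposite.opAddEquiv (α := A)).symm with map_smul' := fun _ _ => rfl }
  exact ⟨inferInstanceAs (Module.Finite A A), inferInstanceAs (Module.Projective A A),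
    Module.Finite.equiv e, Module.Projective.of_equiv e⟩

/-- The zero bimodule. -/
def zero (K A B : Type u) [Field K] [Ring A] [Algebra K A] [Ring B] [Algebra K B] :
    AlgBimodule K A B where
  carrier := PUnit

lemma isProjective_zero : (zero K A B).IsProjective :=
  have : Subsingleton (zero K A B) := inferInstanceAs (Subsingleton PUnit)
  Module.Projective.of_free (R := A ⊗[K] Bᵐᵒᵖ)

/-- The multiplication `A ⊗_A N → N`. -/
def regularTensorHom (N : AlgBimodule K A B) : (regular K A).tensor N →ₗ[A] N :=
  tensorLift (M := regular K A) N.leftMul.toLinearMap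
    (fun m b n => mul_smul (α := A) m b n) (fun a m n => mul_smul (α := A) a m n)

/-- The isomorphism `A ⊗_A N ≅ N ⊕ 0`. -/
def regularTensorIso (N : AlgBimodule K A B) :
    ((regular K A).tensor N).Iso (N.directSum (zero K A B)) where
  toFun x := (regularTensorHom N x, PUnit.unit)
  map_add' x y := Prod.ext (map_add (regularTensorHom N) x y) rfl
  map_smul' k x := Prod.ext ((regularTensorHom N).map_smul_of_tower k x) rfl
  invFun x := tens (regular K A) N (1 : A) x.1
  left_inv x := by
    induction x using tensor_induction with
    | zero => simp
    | tens m n =>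
      refine (tens_balanced (M := regular K A) (1 : A) m n).symm.trans ?_
      exact congrArg (fun a => tens (regular K A) N a n) (one_mul (M := A) m)
    | add x y hx hy => simp only [map_add, hx, hy]
  right_inv x := Prod.ext (one_smul A x.1) rfl
  map_left a x := Prod.ext (map_smul (regularTensorHom N) a x) rfl
  map_right b x := by
    refine Prod.ext ?_ rfl
    change regularTensorHom N (b • x) = b • regularTensorHom N x
    induction x using tensor_induction with
    | zero => simp
    | tens m n => exact smul_comm (M := A) m b n
    | add x y hx hy => simp only [smul_add, map_add, hx, hy]

end Regular

end AlgBimodule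

namespace StablyEquivalentOfMoritaType

open AlgBimodule

variable {K A B : Type u} [Field K] [Ring A] [Algebra K A] [Ring B] [Algebra K B]

lemma symm (h : StablyEquivalentOfMoritaType K A B) : StablyEquivalentOfMoritaType K B A :=
  let ⟨M, N, hM, hN, hP, hQ⟩ := h
  ⟨N, M, hN, hM, hQ, hP⟩

lemma refl : StablyEquivalentOfMoritaType K A A :=
  have h : ∃ P : AlgBimodule K A A, P.IsProjective ∧ Nonempty
      (((regular K A).tensor (regular K A)).Iso ((regular K A).directSum P)) :=
    ⟨zero K A A, isProjective_zero, ⟨regularTensorIso (regular K A)⟩⟩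
  ⟨regular K A, regular K A, isFGProjectiveOnEachSide_regular, isFGProjectiveOnEachSide_regular,
    h, h⟩

theorem exists_bijOn_nilpotentClasses [Module.Finite K A] [Module.Finite K B]
    (hA : ∀ h : HochschildZero K A, (∀ χ, char χ h = 0) → h ∈ nilpotentClasses K A)
    (hB : ∀ h : HochschildZero K B, (∀ χ, char χ h = 0) → h ∈ nilpotentClasses K B)
    (hAB : StablyEquivalentOfMoritaType K A B) :
    ∃ s : HochschildZero K A →ₗ[K] HochschildZero K B,
      Set.BijOn s (nilpotentClasses K A) (nilpotentClasses K B) ∧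
      ∀ z : Subalgebra.center K A, ∃ w : Subalgebra.center K B,
        ∀ h ∈ nilpotentClasses K A, s (z • h) = w • s h := by
  obtain ⟨M, N, ⟨_, _, _, _⟩, ⟨_, _, _, _⟩, ⟨P, hP, ⟨θ⟩⟩, ⟨Q, hQ, ⟨θ'⟩⟩⟩ := hAB
  obtain ⟨D⟩ := FiniteDualBasis.nonempty_of_projective (A := A) (X := M)
  obtain ⟨E⟩ := FiniteDualBasis.nonempty_of_projective (A := B) (X := N)
  have : Module.Finite K M := Module.Finite.trans A M
  have : Module.Finite K N := Module.Finite.trans B N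
  have hMN := exists_center_transfer_smul_transfer D E hP θ
  have hNM := exists_center_transfer_smul_transfer E D hQ θ'
  have hleft : Set.LeftInvOn (M.transfer D) (N.transfer E) (nilpotentClasses K A) := fun h hh => by
    obtain ⟨w, hw₁, hw⟩ := hMN 1
    simpa only [one_smul, hw₁ rfl] using hw h hh
  have hright : Set.RightInvOn (M.transfer D) (N.transfer E) (nilpotentClasses K B) :=
    fun h hh => by
      obtain ⟨w, hw₁, hw⟩ := hNM 1
      simpa only [one_smul, hw₁ rfl] using hw h hh
  have hmapsN : Set.MapsTo (N.transfer E) (nilpotentClasses K A) (nilpotentClasses K B) :=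
    fun h hh => hB _ fun χ => N.char_transfer_of_mem_nilpotentClasses E χ hh
  have hmapsM : Set.MapsTo (M.transfer D) (nilpotentClasses K B) (nilpotentClasses K A) :=
    fun h hh => hA _ fun χ => M.char_transfer_of_mem_nilpotentClasses D χ hh
  refine ⟨N.transfer E, Set.InvOn.bijOn ⟨hleft, hright⟩ hmapsN hmapsM, fun z => ?_⟩
  obtain ⟨w, -, hw⟩ := hNM z
  exact ⟨w, fun h hh => by simpa only [hleft hh] using hw _ (hmapsN hh)⟩

theorem finrank_radicalFiltration_nilpotentClasses_eq [Module.Finite K A] [Module.Finite K B]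
    (hA : ∀ h : HochschildZero K A, (∀ χ, char χ h = 0) → h ∈ nilpotentClasses K A)
    (hB : ∀ h : HochschildZero K B, (∀ χ, char χ h = 0) → h ∈ nilpotentClasses K B)
    (hAB : StablyEquivalentOfMoritaType K A B) (k : ℕ) :
    Module.finrank K (radicalFiltration (nilpotentClasses K A) k) =
      Module.finrank K (radicalFiltration (nilpotentClasses K B) k) := by
  obtain ⟨s, hs, hsz⟩ := exists_bijOn_nilpotentClasses hA hB hAB
  obtain ⟨t, ht, htz⟩ := exists_bijOn_nilpotentClasses hB hA hAB.symm
  exact le_antisymm (finrank_radicalFiltration_le s hs hsz k)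
    (finrank_radicalFiltration_le t ht htz k)

end StablyEquivalentOfMoritaType

/-! ### The algebra `SD(3K)` in cyclic labelling -/

namespace SD3K

/-- The relations of `SD(3K)` in cyclic labelling: the exponents are `n`, the vertices `e i` are
indexed modulo three, `p i` is the arrow `i → i + 1` and `q i` the arrow `i + 1 → i`. -/
structure Relations {R : Type*} [Ring R] (n : Fin 3 → ℕ) (e p q : Fin 3 → R) : Prop where
  idem (i) : e i * e i = e i
  orth (i j) (h : i ≠ j) : e i * e j = 0
  unit : e 0 + e 1 + e 2 = 1
  e_mul_p (i) : e i * p i = p i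
  p_mul_e (i) : p i * e (i + 1) = p i
  e_mul_q (i) : e (i + 1) * q i = q i
  q_mul_e (i) : q i * e i = q i
  q_succ_mul_q (i) : q (i + 1) * q i = 0
  p_mul_p (i) : p (i + 1) * p (i + 2) = (q i * p i) ^ (n i - 1) * q i

/-- The sum of the two cycles of length two between the vertices `i` and `i + 1`. It is central. -/
def twoCycles {R : Type*} [Ring R] (p q : Fin 3 → R) (i : Fin 3) : R := p i * q i + q i * p i

namespace Relations

variable {R : Type*} [Ring R] {n : Fin 3 → ℕ} {e p q : Fin 3 → R}

lemma e_mul_p_of_ne (H : Relations n e p q) {i j : Fin 3} (h : i ≠ j) : e i * p j = 0 := by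
  rw [← H.e_mul_p j, ← mul_assoc, H.orth i j h, zero_mul]

lemma e_mul_q_of_ne (H : Relations n e p q) {i j : Fin 3} (h : i ≠ j + 1) : e i * q j = 0 := by
  rw [← H.e_mul_q j, ← mul_assoc, H.orth i _ h, zero_mul]

lemma p_mul_e_of_ne (H : Relations n e p q) {i j : Fin 3} (h : j ≠ i + 1) : p i * e j = 0 := by
  rw [← H.p_mul_e i, mul_assoc, H.orth _ j h.symm, mul_zero]

lemma q_mul_e_of_ne (H : Relations n e p q) {i j : Fin 3} (h : i ≠ j) : q i * e j = 0 := by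
  rw [← H.q_mul_e i, mul_assoc, H.orth _ j h, mul_zero]

lemma p_mul_p_of_ne (H : Relations n e p q) {i j : Fin 3} (h : j ≠ i + 1) : p i * p j = 0 := by
  rw [← H.e_mul_p j, ← mul_assoc, H.p_mul_e_of_ne h, zero_mul]

lemma p_mul_q_of_ne (H : Relations n e p q) {i j : Fin 3} (h : i ≠ j) : p i * q j = 0 := by
  rw [← H.e_mul_q j, ← mul_assoc, H.p_mul_e_of_ne (by simpa using h.symm), zero_mul]

lemma q_mul_p_of_ne (H : Relations n e p q) {i j : Fin 3} (h : i ≠ j) : q i * p j = 0 := by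
  rw [← H.e_mul_p j, ← mul_assoc, H.q_mul_e_of_ne h, zero_mul]

lemma q_mul_q (H : Relations n e p q) (i j : Fin 3) : q i * q j = 0 := by
  by_cases h : i = j + 1
  · rw [h, H.q_succ_mul_q]
  · rw [← H.e_mul_q j, ← mul_assoc, H.q_mul_e_of_ne h, zero_mul]

lemma twoCycles_mul_e (H : Relations n e p q) (i : Fin 3) : twoCycles p q i * e i = p i * q i := by
  rw [twoCycles, add_mul, mul_assoc, mul_assoc, H.q_mul_e, H.p_mul_e_of_ne (by simp), mul_zero,
    add_zero]

lemma twoCycles_mul_e_succ (H : Relations n e p q) (i : Fin 3) :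
    twoCycles p q i * e (i + 1) = q i * p i := by
  rw [twoCycles, add_mul, mul_assoc, mul_assoc, H.p_mul_e, H.q_mul_e_of_ne (by simp), mul_zero,
    zero_add]

lemma twoCycles_mul_e_of_ne (H : Relations n e p q) {i j : Fin 3} (h : j ≠ i) (h' : j ≠ i + 1) :
    twoCycles p q i * e j = 0 := by
  rw [twoCycles, add_mul, mul_assoc, mul_assoc, H.q_mul_e_of_ne h.symm, H.p_mul_e_of_ne h',
    mul_zero, mul_zero, add_zero]

lemma commute_twoCycles_e (H : Relations n e p q) (i j : Fin 3) :
    Commute (twoCycles p q i) (e j) := by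
  have h1 : e j * (p i * q i) = p i * q i * e j := by
    by_cases h : i = j
    · rw [h, ← mul_assoc, H.e_mul_p, mul_assoc, H.q_mul_e]
    · rw [← mul_assoc, H.e_mul_p_of_ne (Ne.symm h), zero_mul, mul_assoc, H.q_mul_e_of_ne h,
        mul_zero]
  have h2 : e j * (q i * p i) = q i * p i * e j := by
    by_cases h : j = i + 1
    · rw [h, ← mul_assoc, H.e_mul_q, mul_assoc, H.p_mul_e]
    · rw [← mul_assoc, H.e_mul_q_of_ne h, zero_mul, mul_assoc, H.p_mul_e_of_ne h, mul_zero]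
  rw [commute_iff_eq, twoCycles, mul_add, add_mul, h1, h2]

lemma p_mul_q_pow (H : Relations n e p q) (i : Fin 3) (m : ℕ) :
    (p i * q i) ^ (m + 1) = twoCycles p q i ^ (m + 1) * e i := by
  rw [← H.twoCycles_mul_e, (H.commute_twoCycles_e i i).mul_pow,
    IsIdempotentElem.pow_succ_eq _ (H.idem i)]

lemma q_mul_p_pow_mul_q (H : Relations n e p q) (i : Fin 3) (m : ℕ) :
    (q i * p i) ^ m * q i = twoCycles p q i ^ m * q i := by
  cases m with
  | zero => simp
  | succ m =>
    rw [← H.twoCycles_mul_e_succ, (H.commute_twoCycles_e i _).mul_pow,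
      IsIdempotentElem.pow_succ_eq _ (H.idem _), mul_assoc, H.e_mul_q]

lemma p_mul_p_succ (H : Relations n e p q) (i : Fin 3) :
    p i * p (i + 1) = twoCycles p q (i + 2) ^ (n (i + 2) - 1) * q (i + 2) := by
  have h := H.p_mul_p (i + 2)
  have h1 : i + 2 + 1 = i := by lia
  have h2 : i + 2 + 2 = i + 1 := by lia
  rwa [h1, h2, H.q_mul_p_pow_mul_q] at h

lemma commute_twoCycles_q (H : Relations n e p q) (i j : Fin 3) :
    Commute (twoCycles p q i) (q j) := by
  rw [commute_iff_eq, twoCycles, add_mul, mul_add, mul_assoc, H.q_mul_q, mul_zero, zero_add,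
    ← mul_assoc (q j) (q i), H.q_mul_q, zero_mul, add_zero, mul_assoc]
  by_cases h : i = j
  · rw [h]
  · rw [H.p_mul_q_of_ne h, mul_zero, ← mul_assoc, H.q_mul_p_of_ne (Ne.symm h), zero_mul]

lemma q_mul_p_mul_p (H : Relations n e p q) (i j k : Fin 3) : q i * (p j * p k) = 0 := by
  by_cases h : k = j + 1
  · rw [h, H.p_mul_p_succ, ← mul_assoc, ← ((H.commute_twoCycles_q _ i).pow_left _).eq, mul_assoc,
      H.q_mul_q, mul_zero]
  · rw [H.p_mul_p_of_ne h, mul_zero]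

lemma p_mul_p_mul_q (H : Relations n e p q) (i j k : Fin 3) : p i * (p j * q k) = 0 := by
  by_cases h : j = i + 1
  · rw [h, ← mul_assoc, H.p_mul_p_succ, mul_assoc, H.q_mul_q, mul_zero]
  · rw [← mul_assoc, H.p_mul_p_of_ne h, zero_mul]

lemma commute_twoCycles_p (H : Relations n e p q) (i j : Fin 3) :
    Commute (twoCycles p q i) (p j) := by
  rw [commute_iff_eq, twoCycles, add_mul, mul_add, mul_assoc (q i), H.q_mul_p_mul_p, add_zero,
    H.p_mul_p_mul_q, zero_add, mul_assoc]
  by_cases h : i = j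
  · rw [h]
  · rw [H.q_mul_p_of_ne h, mul_zero, ← mul_assoc, H.p_mul_q_of_ne (Ne.symm h), zero_mul]

lemma twoCycles_mul_twoCycles_of_ne (H : Relations n e p q) {i j : Fin 3} (h : i ≠ j) :
    twoCycles p q i * twoCycles p q j = 0 := by
  have hp : twoCycles p q i * p j = 0 := by
    rw [twoCycles, add_mul, mul_assoc, mul_assoc, H.q_mul_p_of_ne h, H.q_mul_p_mul_p, mul_zero,
      add_zero]
  have hq : twoCycles p q i * q j = 0 := by
    rw [twoCycles, add_mul, mul_assoc, mul_assoc, H.q_mul_q, H.p_mul_q_of_ne h, mul_zero, mul_zero,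
      add_zero]
  rw [twoCycles.eq_def p q j, mul_add, ← mul_assoc, hp, ← mul_assoc, hq, zero_mul, zero_mul,
    add_zero]

lemma twoCycles_pow_mul_e (H : Relations n e p q) {i : Fin 3} (hi : 1 ≤ n i) :
    twoCycles p q i ^ n i * e i = p i * (p (i + 1) * p (i + 2)) := by
  rw [H.p_mul_p, H.q_mul_p_pow_mul_q, ← mul_assoc, ← ((H.commute_twoCycles_p i i).pow_left _).eq,
    mul_assoc, ← H.twoCycles_mul_e, ← mul_assoc, ← pow_succ, Nat.sub_add_cancel hi]

lemma twoCycles_pow_eq_zero (H : Relations n e p q) {i : Fin 3} (hi : 1 ≤ n i) :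
    twoCycles p q i ^ (n i + 1) = 0 := by
  have hp : twoCycles p q i ^ n i * p i = 0 := by
    rw [← H.e_mul_p i, ← mul_assoc, H.twoCycles_pow_mul_e hi, ← mul_assoc, H.p_mul_p_succ,
      mul_assoc, mul_assoc, H.q_mul_p_mul_p, mul_zero]
  have hq : twoCycles p q i ^ n i * q i = 0 := by
    rw [((H.commute_twoCycles_q i i).pow_left _).eq, ← H.q_mul_e i, mul_assoc,
      ← ((H.commute_twoCycles_e i i).pow_left _).eq, H.twoCycles_pow_mul_e hi, ← mul_assoc (p i),
      ← mul_assoc (q i), H.q_mul_p_mul_p, zero_mul]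
  rw [pow_succ, twoCycles.eq_def, mul_add, ← twoCycles, ← mul_assoc, hp, ← mul_assoc, hq, zero_mul,
    zero_mul, add_zero]

end Relations

section Presentation

open Vertex Arrow

variable (K : Type u) [Field K] (n : Fin 3 → ℕ)

/-- The algebra `SD(3K)` with its exponents in cyclic labelling: `n i` is the exponent of the
two-cycles between the vertices `i` and `i + 1`. -/
abbrev Cyc : Type u := SD3K K (n 0) (n 2) (n 1)

/-- The projection from the free algebra. -/
def proj : Free K →ₐ[K] Cyc K n := RingQuot.mkAlgHom K (Rel K (n 0) (n 2) (n 1))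

lemma proj_surjective : Function.Surjective (proj K n) := RingQuot.mkAlgHom_surjective K _

variable {K n} in
lemma proj_mul_eq {x y z : Free K} (h : Rel K (n 0) (n 2) (n 1) (x * y) z) :
    proj K n x * proj K n y = proj K n z :=
  (map_mul _ _ _).symm.trans (RingQuot.mkAlgHom_rel K h)

/-- The trivial paths in cyclic labelling. -/
def vtx : Fin 3 → Cyc K n := ![proj K n (e K v0), proj K n (e K v1), proj K n (e K v2)]

/-- The arrows `i → i + 1`. -/
def fwd : Fin 3 → Cyc K n := ![proj K n (ar K β), proj K n (ar K δ), proj K n (ar K lam)]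

/-- The arrows `i + 1 → i`. -/
def bwd : Fin 3 → Cyc K n := ![proj K n (ar K γ), proj K n (ar K η), proj K n (ar K κ)]

lemma relations : Relations n (vtx K n) (fwd K n) (bwd K n) where
  idem i := by
    fin_cases i
    exacts [proj_mul_eq (.idem v0), proj_mul_eq (.idem v1), proj_mul_eq (.idem v2)]
  orth i j h := by
    have orth : ∀ v w : Vertex, v ≠ w → proj K n (e K v) * proj K n (e K w) = 0 := fun v w hvw =>
      (proj_mul_eq (.orth v w hvw)).trans (map_zero _)
    fin_cases i <;> fin_cases j <;> first | exact absurd rfl h | exact orth _ _ (by simp)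
  unit := by
    have h : proj K n _ = proj K n _ := RingQuot.mkAlgHom_rel K .unit
    rwa [map_add, map_add, map_one] at h
  e_mul_p i := by
    fin_cases i
    exacts [proj_mul_eq (.source β), proj_mul_eq (.source δ), proj_mul_eq (.source lam)]
  p_mul_e i := by
    fin_cases i
    exacts [proj_mul_eq (.target β), proj_mul_eq (.target δ), proj_mul_eq (.target lam)]
  e_mul_q i := by
    fin_cases i
    exacts [proj_mul_eq (.source γ), proj_mul_eq (.source η), proj_mul_eq (.source κ)]
  q_mul_e i := by
    fin_cases i
    exacts [proj_mul_eq (.target γ), proj_mul_eq (.target η), proj_mul_eq (.target κ)]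
  q_succ_mul_q i := by
    rw [← map_zero (proj K n)]
    fin_cases i
    exacts [proj_mul_eq .ηγ, proj_mul_eq .κη, proj_mul_eq .γκ]
  p_mul_p i := by
    fin_cases i
    · exact (proj_mul_eq .δlam).trans (by simp [fwd, bwd])
    · exact (proj_mul_eq .lamβ).trans (by simp [fwd, bwd])
    · exact (proj_mul_eq .βδ).trans (by simp [fwd, bwd])

/-- The trivial paths and the arrows. -/
def generator : Fin 3 ⊕ Fin 3 ⊕ Fin 3 → Cyc K n := Sum.elim (vtx K n) (Sum.elim (fwd K n) (bwd K n))

lemma adjoin_range_generator : Algebra.adjoin K (Set.range (generator K n)) = ⊤ := by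
  have h : proj K n '' Set.range (FreeAlgebra.ι K) ⊆ Set.range (generator K n) := by
    rintro _ ⟨_, ⟨v | x, rfl⟩, rfl⟩
    · cases v
      exacts [⟨.inl 0, rfl⟩, ⟨.inl 1, rfl⟩, ⟨.inl 2, rfl⟩]
    · cases x
      exacts [⟨.inr (.inl 0), rfl⟩, ⟨.inr (.inr 0), rfl⟩, ⟨.inr (.inl 1), rfl⟩,
        ⟨.inr (.inr 1), rfl⟩, ⟨.inr (.inl 2), rfl⟩, ⟨.inr (.inr 2), rfl⟩]
  rw [← top_le_iff, ← (AlgHom.range_eq_top (proj K n)).2 (proj_surjective K n), ← Algebra.map_top,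
    ← FreeAlgebra.adjoin_range_ι, AlgHom.map_adjoin]
  exact Algebra.adjoin_mono h

end Presentation

section Lift

open Vertex Arrow

variable {K : Type u} [Field K] {n : Fin 3 → ℕ} {R : Type*} [Ring R] [Algebra K R]
  {e p q : Fin 3 → R}

/-- The images of the trivial paths and of the arrows under `lift`. -/
def liftFun (e p q : Fin 3 → R) : Vertex ⊕ Arrow → R :=
  Sum.elim (fun v => match v with | v0 => e 0 | v1 => e 1 | v2 => e 2)
    (fun a => match a with
      | β => p 0 | δ => p 1 | lam => p 2 | γ => q 0 | η => q 1 | κ => q 2)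

lemma Relations.lift_eq_lift (H : Relations n e p q) {x y : Free K}
    (h : Rel K (n 0) (n 2) (n 1) x y) :
    FreeAlgebra.lift K (liftFun e p q) x = FreeAlgebra.lift K (liftFun e p q) y := by
  cases h with
  | idem v => cases v <;> simp [SD3K.e, liftFun, H.idem]
  | orth v w h =>
    cases v <;> cases w <;> first | exact absurd rfl h | simp [SD3K.e, liftFun, H.orth]
  | unit => simp [SD3K.e, liftFun, H.unit]
  | source a =>
    simp only [map_mul, SD3K.e, ar, FreeAlgebra.lift_ι_apply]
    cases a
    exacts [H.e_mul_p 0, H.e_mul_q 0, H.e_mul_p 1, H.e_mul_q 1, H.e_mul_p 2, H.e_mul_q 2]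
  | target a =>
    simp only [map_mul, SD3K.e, ar, FreeAlgebra.lift_ι_apply]
    cases a
    exacts [H.p_mul_e 0, H.q_mul_e 0, H.p_mul_e 1, H.q_mul_e 1, H.p_mul_e 2, H.q_mul_e 2]
  | κη =>
    simp only [map_mul, map_zero, ar, FreeAlgebra.lift_ι_apply]
    exact H.q_mul_q 2 1
  | ηγ =>
    simp only [map_mul, map_zero, ar, FreeAlgebra.lift_ι_apply]
    exact H.q_mul_q 1 0
  | γκ =>
    simp only [map_mul, map_zero, ar, FreeAlgebra.lift_ι_apply]
    exact H.q_mul_q 0 2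
  | δlam =>
    simp only [map_mul, map_pow, ar, FreeAlgebra.lift_ι_apply]
    exact H.p_mul_p 0
  | βδ =>
    simp only [map_mul, map_pow, ar, FreeAlgebra.lift_ι_apply]
    exact H.p_mul_p 2
  | lamβ =>
    simp only [map_mul, map_pow, ar, FreeAlgebra.lift_ι_apply]
    exact H.p_mul_p 1

/-- The homomorphism defined by elements that satisfy the relations. -/
def lift (H : Relations n e p q) : Cyc K n →ₐ[K] R :=
  RingQuot.liftAlgHom K ⟨FreeAlgebra.lift K (liftFun e p q), fun _ _ => H.lift_eq_lift⟩

variable (H : Relations n e p q)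

lemma lift_proj_ι (g : Vertex ⊕ Arrow) :
    lift (K := K) H (proj K n (FreeAlgebra.ι K g)) = liftFun e p q g :=
  (RingQuot.liftAlgHom_mkAlgHom_apply K _ _ _).trans (FreeAlgebra.lift_ι_apply _ _)

lemma lift_vtx (i : Fin 3) : lift (K := K) H (vtx K n i) = e i := by
  fin_cases i <;> exact lift_proj_ι H _

lemma lift_fwd (i : Fin 3) : lift (K := K) H (fwd K n i) = p i := by
  fin_cases i <;> exact lift_proj_ι H _

lemma lift_bwd (i : Fin 3) : lift (K := K) H (bwd K n i) = q i := by
  fin_cases i <;> exact lift_proj_ι H _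

/-- The character that takes the value one on the trivial path at the vertex `i` and zero on the
other trivial paths and on the arrows. -/
def vtxChar (i : Fin 3) : Cyc K n →ₐ[K] K :=
  lift (e := Pi.single i 1) (p := 0) (q := 0)
    { idem j := by rw [← Pi.mul_apply, ← Pi.single_mul, one_mul]
      orth j k h := by
        by_cases hj : j = i
        · rw [Pi.single_eq_of_ne (fun hk => h (hj.trans hk.symm)), mul_zero]
        · rw [Pi.single_eq_of_ne hj, zero_mul]
      unit := by fin_cases i <;> simp
      e_mul_p := by simp
      p_mul_e := by simp
      e_mul_q := by simp
      q_mul_e := by simp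
      q_succ_mul_q := by simp
      p_mul_p := by simp }

lemma vtxChar_vtx (i j : Fin 3) :
    vtxChar (K := K) (n := n) i (vtx K n j) = Pi.single (M := fun _ => K) i 1 j :=
  lift_vtx _ j

lemma vtxChar_fwd (i j : Fin 3) : vtxChar (K := K) (n := n) i (fwd K n j) = 0 := lift_fwd _ j

lemma vtxChar_bwd (i j : Fin 3) : vtxChar (K := K) (n := n) i (bwd K n j) = 0 := lift_bwd _ j

end Lift

/-! ### The filtration of the zeroth Hochschild homology by powers of two-cycles -/

section Center

variable (K : Type u) [Field K] (n : Fin 3 → ℕ)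

lemma twoCycles_mem_center (i : Fin 3) :
    twoCycles (fwd K n) (bwd K n) i ∈ Subalgebra.center K (Cyc K n) := by
  have H := relations K n
  have h : Algebra.adjoin K (Set.range (generator K n)) ≤
      Subalgebra.centralizer K {twoCycles (fwd K n) (bwd K n) i} := by
    refine Algebra.adjoin_le ?_
    rintro _ ⟨j | j | j, rfl⟩ _ rfl
    exacts [H.commute_twoCycles_e i j, H.commute_twoCycles_p i j, H.commute_twoCycles_q i j]
  rw [adjoin_range_generator] at h
  exact Subalgebra.mem_center_iff.2 fun x => (h (Algebra.mem_top (x := x)) _ rfl).symm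

/-- The sum of the two cycles of length two between `i` and `i + 1`, in the centre. -/
def cycles (i : Fin 3) : Subalgebra.center K (Cyc K n) := ⟨_, twoCycles_mem_center K n i⟩

variable {n}

lemma cycles_mul_cycles_of_ne {i j : Fin 3} (h : i ≠ j) : cycles K n i * cycles K n j = 0 :=
  Subtype.ext ((relations K n).twoCycles_mul_twoCycles_of_ne h)

lemma cycles_pow_eq_zero {i : Fin 3} (hi : 1 ≤ n i) {m : ℕ} (hm : n i < m) :
    cycles K n i ^ m = 0 :=
  pow_eq_zero_of_le hm (Subtype.ext ((relations K n).twoCycles_pow_eq_zero hi))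

variable (n) in
/-- The elements `z ^ m * g`, where `z` is one of the central elements `cycles K n i` and `g` is
a trivial path or an arrow. -/
def monomials : Set (Cyc K n) := {x | ∃ i m g, x = cycles K n i ^ m • generator K n g}

lemma cycles_pow_smul_mem_span_monomials (i : Fin 3) (m : ℕ) {x : Cyc K n}
    (hx : x ∈ Submodule.span K (monomials K n)) :
    cycles K n i ^ m • x ∈ Submodule.span K (monomials K n) := by
  induction hx using Submodule.span_induction with
  | mem x hx =>
    obtain ⟨j, l, g, rfl⟩ := hx
    rw [← mul_smul]
    rcases m with _ | m
    · exact Submodule.subset_span ⟨j, l, g, by rw [pow_zero, one_mul]⟩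
    rcases l with _ | l
    · exact Submodule.subset_span ⟨i, m + 1, g, by rw [pow_zero, mul_one]⟩
    by_cases h : i = j
    · exact Submodule.subset_span ⟨j, m + 1 + (l + 1), g, by rw [h, pow_add _ (m + 1)]⟩
    · rw [pow_succ, pow_succ', mul_assoc, ← mul_assoc (cycles K n i), cycles_mul_cycles_of_ne K h,
        zero_mul, mul_zero, zero_smul]
      exact zero_mem _
  | zero => rw [smul_zero]; exact zero_mem _
  | add x y _ _ hx hy => rw [smul_add]; exact add_mem hx hy
  | smul k x _ hx => rw [smul_comm]; exact Submodule.smul_mem _ k hx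

lemma generator_mul_generator_mem_span_monomials (g g' : Fin 3 ⊕ Fin 3 ⊕ Fin 3) :
    generator K n g * generator K n g' ∈ Submodule.span K (monomials K n) := by
  have H := relations K n
  have hzero {x : Cyc K n} (hx : x = 0) : x ∈ Submodule.span K (monomials K n) := hx ▸ zero_mem _
  have hmonomial {x : Cyc K n} (i m g)
      (hx : x = twoCycles (fwd K n) (bwd K n) i ^ m * generator K n g) :
      x ∈ Submodule.span K (monomials K n) := Submodule.subset_span ⟨i, m, g, hx⟩
  have hgenerator {x : Cyc K n} (g) (hx : x = generator K n g) :
      x ∈ Submodule.span K (monomials K n) := hmonomial 0 0 g (by rw [hx, pow_zero, one_mul])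
  rcases g with i | i | i <;> rcases g' with j | j | j
  · by_cases h : i = j
    exacts [hgenerator (.inl i) (h ▸ H.idem i), hzero (H.orth i j h)]
  · by_cases h : i = j
    exacts [hgenerator (.inr (.inl j)) (h ▸ H.e_mul_p j), hzero (H.e_mul_p_of_ne h)]
  · by_cases h : i = j + 1
    exacts [hgenerator (.inr (.inr j)) (h ▸ H.e_mul_q j), hzero (H.e_mul_q_of_ne h)]
  · by_cases h : j = i + 1
    exacts [hgenerator (.inr (.inl i)) (h ▸ H.p_mul_e i), hzero (H.p_mul_e_of_ne h)]
  · by_cases h : j = i + 1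
    exacts [hmonomial (i + 2) (n (i + 2) - 1) (.inr (.inr (i + 2))) (h ▸ H.p_mul_p_succ i),
      hzero (H.p_mul_p_of_ne h)]
  · by_cases h : i = j
    exacts [hmonomial i 1 (.inl i) (by rw [pow_one]; exact h ▸ (H.twoCycles_mul_e i).symm),
      hzero (H.p_mul_q_of_ne h)]
  · by_cases h : i = j
    exacts [hgenerator (.inr (.inr i)) (h ▸ H.q_mul_e i), hzero (H.q_mul_e_of_ne h)]
  · by_cases h : i = j
    exacts [hmonomial i 1 (.inl (i + 1))
      (by rw [pow_one]; exact h ▸ (H.twoCycles_mul_e_succ i).symm), hzero (H.q_mul_p_of_ne h)]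
  · exact hzero (H.q_mul_q i j)

variable (n) in
lemma span_monomials : Submodule.span K (monomials K n) = ⊤ := by
  set S := Submodule.span K (monomials K n)
  have hgenerator (g) : generator K n g ∈ S :=
    Submodule.subset_span ⟨0, 0, g, by rw [pow_zero, one_smul]⟩
  have hone : 1 ∈ S := by
    rw [← (relations K n).unit]
    exact add_mem (add_mem (hgenerator (.inl 0)) (hgenerator (.inl 1))) (hgenerator (.inl 2))
  have hmul : S * S ≤ S := by
    rw [Submodule.span_mul_span, Submodule.span_le]
    rintro _ ⟨_, ⟨i, m, g, rfl⟩, _, ⟨j, l, g', rfl⟩, rfl⟩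
    change cycles K n i ^ m • generator K n g * cycles K n j ^ l • generator K n g' ∈ S
    have hcomm : generator K n g * cycles K n j ^ l • generator K n g' =
        cycles K n j ^ l • (generator K n g * generator K n g') := by
      rw [Subalgebra.smul_def, Subalgebra.smul_def, smul_eq_mul, smul_eq_mul, ← mul_assoc,
        Subalgebra.mem_center_iff.1 (cycles K n j ^ l).2, mul_assoc]
    rw [smul_mul_assoc, hcomm]
    exact cycles_pow_smul_mem_span_monomials K i m (cycles_pow_smul_mem_span_monomials K j l
      (generator_mul_generator_mem_span_monomials K g g'))
  have hadjoin : Algebra.adjoin K (Set.range (generator K n)) ≤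
      S.toSubalgebra hone fun x y hx hy => hmul (Submodule.mul_mem_mul hx hy) :=
    Algebra.adjoin_le (Set.range_subset_iff.2 hgenerator)
  rw [adjoin_range_generator] at hadjoin
  exact eq_top_iff.2 fun x _ => hadjoin Algebra.mem_top

lemma finite (hn : ∀ i, 1 ≤ n i) : Module.Finite K (Cyc K n) := by
  let f : (Σ i : Fin 3, Fin (n i + 1)) × (Fin 3 ⊕ Fin 3 ⊕ Fin 3) → Cyc K n :=
    fun x => cycles K n x.1.1 ^ (x.1.2 : ℕ) • generator K n x.2
  have hf : monomials K n ⊆ insert 0 (Set.range f) := by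
    rintro _ ⟨i, m, g, rfl⟩
    by_cases hm : n i < m
    · exact .inl (by rw [cycles_pow_eq_zero K (hn i) hm, zero_smul])
    · exact .inr ⟨(⟨i, m, by lia⟩, g), rfl⟩
  exact ⟨Submodule.fg_def.2 ⟨_, ((Set.finite_range f).insert 0).subset hf, span_monomials K n⟩⟩

end Center

section CycleClass

variable {K : Type u} [Field K] {n : Fin 3 → ℕ}

lemma vtxChar_cycles (i j : Fin 3) : vtxChar j (cycles K n i : Cyc K n) = 0 := by
  simp [cycles, twoCycles, vtxChar_fwd]

lemma cl_generator_mul_vtx (g : Fin 3 ⊕ Fin 3 ⊕ Fin 3) (j : Fin 3) :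
    cl K (generator K n g * vtx K n j) = vtxChar j (generator K n g) • cl K (vtx K n j) := by
  have H := relations K n
  rcases g with i | i | i
  · change cl K (vtx K n i * vtx K n j) = vtxChar j (vtx K n i) • cl K (vtx K n j)
    rw [vtxChar_vtx]
    by_cases h : i = j
    · rw [h, H.idem, Pi.single_eq_same, one_smul]
    · rw [H.orth i j h, Pi.single_eq_of_ne h, zero_smul, map_zero]
  · change cl K (fwd K n i * vtx K n j) = vtxChar j (fwd K n i) • cl K (vtx K n j)
    rw [vtxChar_fwd, zero_smul]
    by_cases h : j = i
    · rw [H.p_mul_e_of_ne (by simp [h]), map_zero]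
    · rw [cl_mul_comm, H.e_mul_p_of_ne h, map_zero]
  · change cl K (bwd K n i * vtx K n j) = vtxChar j (bwd K n i) • cl K (vtx K n j)
    rw [vtxChar_bwd, zero_smul]
    by_cases h : i = j
    · rw [cl_mul_comm, H.e_mul_q_of_ne (by simp [h]), map_zero]
    · rw [H.q_mul_e_of_ne h, map_zero]

lemma cl_mul_vtx_sub_mem (x : Cyc K n) (j : Fin 3) :
    cl K (x * vtx K n j) - vtxChar j x • cl K (vtx K n j) ∈
      Submodule.span K {h | ∃ i m, h = cycles K n i ^ (m + 1) • cl K (vtx K n j)} := by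
  let f : Cyc K n →ₗ[K] HochschildZero K (Cyc K n) :=
    cl K ∘ₗ LinearMap.mulRight K (vtx K n j) -
      (vtxChar j).toLinearMap.smulRight (cl K (vtx K n j))
  have hf : Submodule.span K (monomials K n) ≤ Submodule.comap f
      (Submodule.span K {h | ∃ i m, h = cycles K n i ^ (m + 1) • cl K (vtx K n j)}) := by
    refine Submodule.span_le.2 ?_
    rintro _ ⟨i, m, g, rfl⟩
    have hcl : cl K (cycles K n i ^ m • generator K n g * vtx K n j) =
        vtxChar j (generator K n g) • cycles K n i ^ m • cl K (vtx K n j) := by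
      rw [smul_comm, ← cl_generator_mul_vtx, center_smul_cl, ← mul_assoc]
      rfl
    have hχ : vtxChar j (cycles K n i ^ m • generator K n g) =
        vtxChar j (cycles K n i : Cyc K n) ^ m * vtxChar j (generator K n g) := by
      rw [← map_pow, ← map_mul]
      rfl
    rw [SetLike.mem_coe, Submodule.mem_comap]
    change cl K (cycles K n i ^ m • generator K n g * vtx K n j) -
      vtxChar j (cycles K n i ^ m • generator K n g) • cl K (vtx K n j) ∈ Submodule.span K _
    rw [hcl, hχ, vtxChar_cycles]
    cases m with
    | zero => simp
    | succ m =>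
      rw [zero_pow m.succ_ne_zero, zero_mul, zero_smul, sub_zero]
      exact Submodule.smul_mem _ _ (Submodule.subset_span ⟨i, m, rfl⟩)
  rw [span_monomials] at hf
  exact hf (Submodule.mem_top (x := x))

variable (K n) in
/-- For `1 ≤ m`, the class of the `m`-th power of a cycle of length two between the vertices `i`
and `i + 1`; both cycles define the same class. -/
def cycleClass (i : Fin 3) (m : ℕ) : HochschildZero K (Cyc K n) :=
  cycles K n i ^ m • cl K (vtx K n i)

lemma cycles_pow_smul_cycleClass (i : Fin 3) (l m : ℕ) :
    cycles K n i ^ l • cycleClass K n i m = cycleClass K n i (l + m) := by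
  rw [cycleClass, ← mul_smul, ← pow_add, cycleClass]

lemma cycles_pow_smul_cycleClass_of_ne {i j : Fin 3} (h : i ≠ j) {l m : ℕ} (hl : 1 ≤ l)
    (hm : 1 ≤ m) : cycles K n i ^ l • cycleClass K n j m = 0 := by
  obtain ⟨l, rfl⟩ := Nat.exists_eq_add_of_le' hl
  obtain ⟨m, rfl⟩ := Nat.exists_eq_add_of_le' hm
  rw [cycleClass, ← mul_smul, pow_succ, pow_succ', mul_assoc, ← mul_assoc (cycles K n i),
    cycles_mul_cycles_of_ne K h, zero_mul, mul_zero, zero_smul]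

lemma cycleClass_eq_zero {i : Fin 3} (hi : 1 ≤ n i) {m : ℕ} (hm : n i < m) :
    cycleClass K n i m = 0 := by
  rw [cycleClass, cycles_pow_eq_zero K hi hm, zero_smul]

lemma cycleClass_succ (i : Fin 3) (m : ℕ) :
    cycleClass K n i (m + 1) = cl K ((fwd K n i * bwd K n i) ^ (m + 1)) := by
  rw [(relations K n).p_mul_q_pow]
  rfl

lemma cycleClass_exponent {i : Fin 3} (hi : 1 ≤ n i) :
    cycleClass K n i (n i) = cl K (fwd K n 0 * (fwd K n 1 * fwd K n 2)) := by
  have hrot : cl K (fwd K n 1 * (fwd K n 2 * fwd K n 0)) =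
      cl K (fwd K n 0 * (fwd K n 1 * fwd K n 2)) := by rw [← mul_assoc, cl_mul_comm]
  have hrot' : cl K (fwd K n 2 * (fwd K n 0 * fwd K n 1)) =
      cl K (fwd K n 0 * (fwd K n 1 * fwd K n 2)) := by rw [cl_mul_comm, mul_assoc]
  have h : cycleClass K n i (n i) = cl K (fwd K n i * (fwd K n (i + 1) * fwd K n (i + 2))) := by
    rw [← (relations K n).twoCycles_pow_mul_e hi]
    rfl
  rw [h]
  fin_cases i
  exacts [rfl, hrot, hrot']

lemma cycles_pow_succ_smul_cl_vtx (i j : Fin 3) (m : ℕ) :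
    cycles K n i ^ (m + 1) • cl K (vtx K n j) = 0 ∨
      cycles K n i ^ (m + 1) • cl K (vtx K n j) = cycleClass K n i (m + 1) := by
  have H := relations K n
  have hcl (j) : cycles K n i • cl K (vtx K n j) =
    cl K (twoCycles (fwd K n) (bwd K n) i * vtx K n j) := rfl
  rw [cycleClass, pow_succ, mul_smul, mul_smul, hcl, hcl, H.twoCycles_mul_e]
  by_cases h : j = i
  · exact .inr (by rw [h, H.twoCycles_mul_e])
  by_cases h' : j = i + 1
  · exact .inr (by rw [h', H.twoCycles_mul_e_succ, cl_mul_comm])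
  · exact .inl (by rw [H.twoCycles_mul_e_of_ne h h', map_zero, smul_zero])

variable (K n) in
/-- The span of the classes of the powers with exponent larger than `k` of the cycles of length
two. -/
def cycleSpan (k : ℕ) : Submodule K (HochschildZero K (Cyc K n)) :=
  ⨆ i, Submodule.span K (cycleClass K n i '' Set.Ioi k)

lemma span_cycleClass_le_cycleSpan (i : Fin 3) (k : ℕ) :
    Submodule.span K (cycleClass K n i '' Set.Ioi k) ≤ cycleSpan K n k :=
  le_iSup (fun i => Submodule.span K (cycleClass K n i '' Set.Ioi k)) i

lemma cycleClass_mem_cycleSpan (i : Fin 3) {k m : ℕ} (h : k < m) :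
    cycleClass K n i m ∈ cycleSpan K n k :=
  span_cycleClass_le_cycleSpan i k (Submodule.subset_span ⟨m, h, rfl⟩)

lemma cycleSpan_le_iff {k : ℕ} {S : Submodule K (HochschildZero K (Cyc K n))} :
    cycleSpan K n k ≤ S ↔ ∀ i, ∀ m > k, cycleClass K n i m ∈ S := by
  simp only [cycleSpan, iSup_le_iff, Submodule.span_le, Set.image_subset_iff]
  rfl

lemma mem_cycleSpan_zero {h : HochschildZero K (Cyc K n)}
    (hh : ∀ χ : Cyc K n →ₐ[K] K, char χ h = 0) : h ∈ cycleSpan K n 0 := by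
  obtain ⟨x, rfl⟩ := cl_surjective K h
  have hle (j : Fin 3) :
      Submodule.span K {h | ∃ i m, h = cycles K n i ^ (m + 1) • cl K (vtx K n j)} ≤
        cycleSpan K n 0 := by
    refine Submodule.span_le.2 ?_
    rintro _ ⟨i, m, rfl⟩
    rcases cycles_pow_succ_smul_cl_vtx (K := K) (n := n) i j m with h | h <;> rw [h]
    exacts [zero_mem _, cycleClass_mem_cycleSpan i m.succ_pos]
  have hmem (j : Fin 3) : cl K (x * vtx K n j) ∈ cycleSpan K n 0 := by
    have hx := hle j (cl_mul_vtx_sub_mem x j)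
    rwa [← char_cl, hh, zero_smul, sub_zero] at hx
  rw [← mul_one x, ← (relations K n).unit, mul_add, mul_add, map_add, map_add]
  exact add_mem (add_mem (hmem 0) (hmem 1)) (hmem 2)

lemma restrictScalars_nilpotentClasses_eq_cycleSpan (hn : ∀ i, 1 ≤ n i) :
    (nilpotentClasses K (Cyc K n)).restrictScalars K = cycleSpan K n 0 := by
  refine le_antisymm
    (fun h hh => mem_cycleSpan_zero fun χ => char_eq_zero_of_mem_nilpotentClasses χ hh)
    (cycleSpan_le_iff.2 fun i m hm => ?_)
  have hnil : IsNilpotent (fwd K n i * bwd K n i) := ⟨n i + 1, by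
    rw [(relations K n).p_mul_q_pow, (relations K n).twoCycles_pow_eq_zero (hn i), zero_mul]⟩
  obtain ⟨m, rfl⟩ := Nat.exists_eq_add_of_le' (Nat.succ_le_of_lt hm)
  rw [cycleClass_succ]
  exact cl_mem_nilpotentClasses (hnil.pow_succ m)

lemma smul_cycleClass_sub_mem (w : Subalgebra.center K (Cyc K n)) (j : Fin 3) {m : ℕ}
    (hm : 1 ≤ m) :
    w • cycleClass K n j m - vtxChar j (w : Cyc K n) • cycleClass K n j m ∈
      Submodule.span K (cycleClass K n j '' Set.Ioi m) := by
  let f := Module.toModuleEnd K (S := Subalgebra.center K (Cyc K n)) (HochschildZero K (Cyc K n))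
    (cycles K n j ^ m)
  have hf : Submodule.span K {h | ∃ i l, h = cycles K n i ^ (l + 1) • cl K (vtx K n j)} ≤
      (Submodule.span K (cycleClass K n j '' Set.Ioi m)).comap f := by
    refine Submodule.span_le.2 ?_
    rintro _ ⟨i, l, rfl⟩
    have hfi : f (cycles K n i ^ (l + 1) • cl K (vtx K n j)) =
        cycles K n i ^ (l + 1) • cycleClass K n j m := smul_comm _ _ _
    rw [SetLike.mem_coe, Submodule.mem_comap, hfi]
    by_cases h : i = j
    · rw [h, cycles_pow_smul_cycleClass]
      exact Submodule.subset_span ⟨_, Set.mem_Ioi.2 (by lia), rfl⟩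
    · rw [cycles_pow_smul_cycleClass_of_ne h l.succ_pos hm]
      exact zero_mem _
  have h := hf (cl_mul_vtx_sub_mem (w : Cyc K n) j)
  have hfw : f (cl K (w * vtx K n j)) = w • cycleClass K n j m := by
    rw [← center_smul_cl]
    exact smul_comm _ _ _
  rwa [Submodule.mem_comap, map_sub, map_smul, hfw] at h

lemma smul_cycleClass_exponent (w : Subalgebra.center K (Cyc K n)) {j : Fin 3} (hj : 1 ≤ n j) :
    w • cycleClass K n j (n j) = vtxChar j (w : Cyc K n) • cycleClass K n j (n j) := by
  have h := smul_cycleClass_sub_mem w j hj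
  have hbot : Submodule.span K (cycleClass K n j '' Set.Ioi (n j)) = ⊥ := by
    refine Submodule.span_eq_bot.2 ?_
    rintro _ ⟨m, hm, rfl⟩
    exact cycleClass_eq_zero hj hm
  rwa [hbot, Submodule.mem_bot, sub_eq_zero] at h

end CycleClass

end SD3K

/-! ### A functional that does not vanish on the socle -/

section ApolarIdeal

variable {K R : Type*} [CommRing K] [CommRing R] [Algebra K R] (φ : R →ₗ[K] K)

/-- The largest ideal in the kernel of a functional. -/
def apolarIdeal : Ideal R where
  carrier := {x | ∀ y, φ (x * y) = 0}
  add_mem' hx hx' y := by rw [add_mul, map_add, hx y, hx' y, add_zero]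
  zero_mem' y := by rw [zero_mul, map_zero]
  smul_mem' z x hx y := by rw [smul_eq_mul, mul_comm z, mul_assoc, hx]

lemma mk_apolarIdeal_eq_mk_iff {x y : R} :
    Ideal.Quotient.mk (apolarIdeal φ) x = Ideal.Quotient.mk (apolarIdeal φ) y ↔
      ∀ z, φ (x * z) = φ (y * z) := by
  rw [Ideal.Quotient.eq]
  refine forall_congr' fun z => ?_
  rw [sub_mul, map_sub, sub_eq_zero]

/-- The functional that `φ` induces on the quotient by its apolar ideal. -/
def apolarFunctional : R ⧸ apolarIdeal φ →ₗ[K] K :=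
  ((apolarIdeal φ).restrictScalars K).liftQ φ (fun x hx => by simpa using hx 1) ∘ₗ
    (Submodule.Quotient.restrictScalarsEquiv K (apolarIdeal φ)).symm.toLinearMap

lemma apolarFunctional_mk (x : R) : apolarFunctional φ (Ideal.Quotient.mk _ x) = φ x := rfl

end ApolarIdeal

namespace SD3K

section Matrix

variable {R : Type*} [CommRing R]

lemma single_mul_single_pow (i j : Fin 3) (x y : R) (m : ℕ) :
    (Matrix.single i j x * Matrix.single j i y) ^ (m + 1) =
      Matrix.single i i ((x * y) ^ (m + 1)) := by
  induction m with
  | zero => rw [pow_one, pow_one, Matrix.single_mul_single_same]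
  | succ m ih => rw [pow_succ, ih, Matrix.single_mul_single_same, Matrix.single_mul_single_same,
      ← pow_succ]

lemma Relations.matrix {n : Fin 3 → ℕ} {p q : Fin 3 → R} (hq : ∀ i, q (i + 1) * q i = 0)
    (hp : ∀ i, p (i + 1) * p (i + 2) = (q i * p i) ^ (n i - 1) * q i) :
    Relations n (fun i => Matrix.single i i (1 : R)) (fun i => Matrix.single i (i + 1) (p i))
      (fun i => Matrix.single (i + 1) i (q i)) where
  idem i := by simp
  orth i j h := Matrix.single_mul_single_of_ne _ _ _ _ h _
  unit := by
    ext i j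
    fin_cases i <;> fin_cases j <;> simp [Matrix.single]
  e_mul_p i := by simp
  p_mul_e i := by simp
  e_mul_q i := by simp
  q_mul_e i := by simp
  q_succ_mul_q i := by simp [hq]
  p_mul_p i := by
    have h : i + 2 + 1 = i := by rw [add_assoc]; exact add_zero i
    have h' : i + 1 + 1 = i + 2 := by rw [add_assoc]; rfl
    rw [h, h', Matrix.single_mul_single_same, hp]
    rcases n i - 1 with _ | m
    · simp
    · rw [single_mul_single_pow, Matrix.single_mul_single_same]

end Matrix

section Socle

open MvPolynomial

/-- The exponent of `x i * y i` in the polynomial ring with variables `x i = X (.inl i)` and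
`y i = X (.inr i)`. -/
def twoCycleExp (i : Fin 3) : Fin 3 ⊕ Fin 3 →₀ ℕ := .single (.inl i) 1 + .single (.inr i) 1

/-- The exponent of `x 0 * x 1 * x 2`. -/
def threeCycleExp : Fin 3 ⊕ Fin 3 →₀ ℕ := ∑ i, .single (.inl i) 1

lemma twoCycleExp_inl (i j : Fin 3) : twoCycleExp i (.inl j) = if i = j then 1 else 0 := by
  simp [twoCycleExp, Finsupp.single_apply]

lemma twoCycleExp_inr (i j : Fin 3) : twoCycleExp i (.inr j) = if i = j then 1 else 0 := by
  simp [twoCycleExp, Finsupp.single_apply]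

lemma threeCycleExp_inl (j : Fin 3) : threeCycleExp (.inl j) = 1 := by
  simp [threeCycleExp, Finsupp.single_apply]

lemma threeCycleExp_inr (j : Fin 3) : threeCycleExp (.inr j) = 0 := by
  simp [threeCycleExp]

lemma threeCycleExp_eq (i : Fin 3) :
    threeCycleExp = .single (.inl (i + 1)) 1 + .single (.inl (i + 2)) 1 + .single (.inl i) 1 := by
  rw [threeCycleExp, Fin.sum_univ_three]
  fin_cases i
  · exact (add_assoc _ _ _).trans (add_comm _ _)
  · exact (add_rotate _ _ _).symm
  · rfl

lemma smul_twoCycleExp_eq {m : ℕ} (hm : 1 ≤ m) (i : Fin 3) :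
    m • twoCycleExp i =
      (m - 1) • twoCycleExp i + .single (.inr i) 1 + .single (.inl i) 1 := by
  conv_lhs => rw [← Nat.sub_add_cancel hm, add_smul, one_smul, twoCycleExp]
  rw [twoCycleExp, add_assoc, add_comm (Finsupp.single (Sum.inr i) 1)]

lemma not_inr_add_inr_le_smul_twoCycleExp (i j : Fin 3) (m : ℕ) :
    ¬ (.single (.inr (j + 1)) 1 + .single (.inr j) 1 : Fin 3 ⊕ Fin 3 →₀ ℕ) ≤
      m • twoCycleExp i := by
  intro h
  have h1 := h (.inr (j + 1))
  have h2 := h (.inr j)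
  simp only [Finsupp.add_apply, Finsupp.smul_apply, twoCycleExp_inr] at h1 h2
  by_cases hi : i = j
  · simp [hi] at h1
  · simp [hi] at h2

lemma not_inl_add_inl_le_smul_twoCycleExp (i j : Fin 3) (m : ℕ) :
    ¬ (.single (.inl (j + 1)) 1 + .single (.inl (j + 2)) 1 : Fin 3 ⊕ Fin 3 →₀ ℕ) ≤
      m • twoCycleExp i := by
  intro h
  have h1 := h (.inl (j + 1))
  have h2 := h (.inl (j + 2))
  simp only [Finsupp.add_apply, Finsupp.smul_apply, twoCycleExp_inl] at h1 h2
  by_cases hi : i = j + 1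
  · simp [hi] at h2
  · simp [hi] at h1

lemma eq_of_add_inr_le_smul_twoCycleExp {i j : Fin 3} {l m : ℕ}
    (h : l • twoCycleExp j + .single (.inr j) 1 ≤ m • twoCycleExp i) : i = j := by
  have h1 := h (.inr j)
  by_contra hi
  simp [twoCycleExp_inr, hi] at h1

lemma not_add_inr_le_threeCycleExp (d : Fin 3 ⊕ Fin 3 →₀ ℕ) (j : Fin 3) :
    ¬ d + .single (.inr j) 1 ≤ threeCycleExp := by
  intro h
  have h1 := h (.inr j)
  simp [threeCycleExp_inr] at h1

lemma smul_twoCycleExp_ne_threeCycleExp (i : Fin 3) (m : ℕ) :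
    m • twoCycleExp i ≠ threeCycleExp := by
  intro h
  have h1 := DFunLike.congr_fun h (.inl (i + 1))
  simp [twoCycleExp_inl, threeCycleExp_inl] at h1

lemma smul_twoCycleExp_inj {i j : Fin 3} {l m : ℕ} (hm : 1 ≤ m) :
    l • twoCycleExp i = m • twoCycleExp j ↔ i = j ∧ l = m := by
  refine ⟨fun h => ?_, fun h => by rw [h.1, h.2]⟩
  have h1 := DFunLike.congr_fun h (.inr j)
  by_cases hi : i = j
  · exact ⟨hi, by simpa [twoCycleExp_inr, hi] using h1⟩
  · have hm0 : m = 0 := by simpa [twoCycleExp_inr, hi] using h1.symm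
    exact absurd hm (by rw [hm0]; exact Nat.not_succ_le_zero 0)

variable (K : Type u) [Field K] (n : Fin 3 → ℕ)

/-- The functional on the polynomial ring with value `1` on the monomials `(x i * y i) ^ n i` and
`x 0 * x 1 * x 2` and value `0` on all other monomials. -/
def socleCoeff : MvPolynomial (Fin 3 ⊕ Fin 3) K →ₗ[K] K :=
  lcoeff K threeCycleExp + ∑ i, lcoeff K (n i • twoCycleExp i)

lemma socleCoeff_apply (f : MvPolynomial (Fin 3 ⊕ Fin 3) K) :
    socleCoeff K n f = coeff threeCycleExp f + ∑ i, coeff (n i • twoCycleExp i) f := by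
  simp [socleCoeff]

variable {n}

lemma socleCoeff_inr_mul_inr (i : Fin 3) (f : MvPolynomial (Fin 3 ⊕ Fin 3) K) :
    socleCoeff K n (X (.inr (i + 1)) * X (.inr i) * f) = 0 := by
  simp only [X, monomial_mul, mul_one, socleCoeff_apply, coeff_monomial_mul',
    not_inr_add_inr_le_smul_twoCycleExp, not_add_inr_le_threeCycleExp, if_false,
    Finset.sum_const_zero, add_zero]

lemma socleCoeff_inl_mul_inl (hn : ∀ i, 1 ≤ n i) (i : Fin 3)
    (f : MvPolynomial (Fin 3 ⊕ Fin 3) K) :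
    socleCoeff K n (X (.inl (i + 1)) * X (.inl (i + 2)) * f) =
      socleCoeff K n ((X (.inr i) * X (.inl i)) ^ (n i - 1) * X (.inr i) * f) := by
  rw [mul_comm (X (.inr i) : MvPolynomial (Fin 3 ⊕ Fin 3) K)]
  simp only [X, monomial_mul, monomial_pow, one_pow, mul_one, socleCoeff_apply,
    coeff_monomial_mul', not_inl_add_inl_le_smul_twoCycleExp, if_false, Finset.sum_const_zero,
    add_zero]
  rw [← twoCycleExp, if_neg (not_add_inr_le_threeCycleExp _ i), Finset.sum_eq_single i,
    threeCycleExp_eq i, smul_twoCycleExp_eq (hn i), if_pos le_self_add, if_pos le_self_add,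
    add_tsub_cancel_left, add_tsub_cancel_left, zero_add]
  · exact fun j _ hj => if_neg fun h => hj (eq_of_add_inr_le_smul_twoCycleExp h)
  · exact fun h => (h (Finset.mem_univ i)).elim

lemma socleCoeff_inl_mul_inr_pow (hn : ∀ i, 1 ≤ n i) (i : Fin 3) (m : ℕ) :
    socleCoeff K n ((X (.inl i) * X (.inr i)) ^ m) = if m = n i then 1 else 0 := by
  simp only [X, monomial_mul, monomial_pow, one_pow, mul_one, socleCoeff_apply, coeff_monomial]
  rw [← twoCycleExp, if_neg (smul_twoCycleExp_ne_threeCycleExp i m), zero_add]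
  simp only [smul_twoCycleExp_inj (hn _), ite_and, Finset.sum_ite_eq, Finset.mem_univ, if_true]

lemma apolarRelations (hn : ∀ i, 1 ≤ n i) :
    Relations n (fun i => Matrix.single i i 1)
      (fun i => Matrix.single i (i + 1)
        (Ideal.Quotient.mk (apolarIdeal (socleCoeff K n)) (X (.inl i))))
      (fun i => Matrix.single (i + 1) i (Ideal.Quotient.mk _ (X (.inr i)))) := by
  refine Relations.matrix (fun i => ?_) (fun i => ?_)
  · rw [← map_mul, ← map_zero (Ideal.Quotient.mk _), mk_apolarIdeal_eq_mk_iff]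
    intro f
    rw [socleCoeff_inr_mul_inr, zero_mul, map_zero]
  · rw [← map_mul, ← map_mul, ← map_pow, ← map_mul, mk_apolarIdeal_eq_mk_iff]
    exact socleCoeff_inl_mul_inl K hn i

variable {K}

/-- The composition of `socleCoeff`, on the quotient of the polynomial ring by its apolar ideal,
with the trace of the representation by matrices over this quotient. -/
def socleFunctional (hn : ∀ i, 1 ≤ n i) : HochschildZero K (Cyc K n) →ₗ[K] K :=
  HochschildZero.lift (apolarFunctional (socleCoeff K n) ∘ₗ Matrix.traceLinearMap (Fin 3) K _ ∘ₗ
    (lift (apolarRelations K hn)).toLinearMap) fun u v => by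
      simp only [LinearMap.comp_apply, AlgHom.toLinearMap_apply, map_mul (lift _),
        Matrix.traceLinearMap_apply]
      rw [Matrix.trace_mul_comm]

lemma socleFunctional_cycleClass (hn : ∀ i, 1 ≤ n i) (i : Fin 3) {m : ℕ} (hm : 1 ≤ m) :
    socleFunctional hn (cycleClass K n i m) = if m = n i then 1 else 0 := by
  obtain ⟨m, rfl⟩ := Nat.exists_eq_add_of_le' hm
  rw [cycleClass_succ, socleFunctional, HochschildZero.lift_cl, LinearMap.comp_apply,
    LinearMap.comp_apply, AlgHom.toLinearMap_apply, map_pow, map_mul, lift_fwd, lift_bwd,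
    single_mul_single_pow, Matrix.traceLinearMap_apply, Matrix.trace_single_eq_same, ← map_mul,
    ← map_pow, apolarFunctional_mk, socleCoeff_inl_mul_inr_pow K hn]

lemma cycleClass_exponent_ne_zero (hn : ∀ i, 1 ≤ n i) (i : Fin 3) :
    cycleClass K n i (n i) ≠ 0 := fun h => by
  have h1 := socleFunctional_cycleClass (K := K) hn i (hn i)
  rw [h, map_zero, if_pos rfl] at h1
  exact zero_ne_one h1

end Socle

/-! ### The dimensions of the filtration -/

variable {K : Type u} [Field K] {n : Fin 3 → ℕ}

variable (K n) in
/-- A basis of `cycleSpan K n k`, provided that some exponent is larger than `k`. -/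
def cycleFamily (k : ℕ) : Option (Σ i : Fin 3, Fin (n i - 1 - k)) → HochschildZero K (Cyc K n)
  | none => cycleClass K n 0 (n 0)
  | some x => cycleClass K n x.1 (k + x.2 + 1)

/-- The functional that takes the value `1` on `cycleClass K n i m` and vanishes on all other
classes of powers of cycles, for `m < n i`. -/
def cycleFunctional (hn : ∀ i, 1 ≤ n i) (i : Fin 3) (m : ℕ) :
    HochschildZero K (Cyc K n) →ₗ[K] K :=
  socleFunctional hn ∘ₗ Module.toModuleEnd K (S := Subalgebra.center K (Cyc K n))
    (HochschildZero K (Cyc K n)) (cycles K n i ^ (n i - m))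

lemma cycleFunctional_cycleClass (hn : ∀ i, 1 ≤ n i) {i : Fin 3} {m : ℕ} (hm : m < n i)
    (j : Fin 3) {l : ℕ} (hl : 1 ≤ l) :
    cycleFunctional hn i m (cycleClass K n j l) = if i = j ∧ l = m then 1 else 0 := by
  change socleFunctional hn (cycles K n i ^ (n i - m) • cycleClass K n j l) = _
  by_cases h : i = j
  · rw [← h, cycles_pow_smul_cycleClass, socleFunctional_cycleClass hn i (by lia)]
    exact if_congr (by lia) rfl rfl
  · rw [cycles_pow_smul_cycleClass_of_ne h (by lia) hl, map_zero, if_neg fun h' => h h'.1]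

lemma linearIndependent_cycleFamily (hn : ∀ i, 1 ≤ n i) (k : ℕ) :
    LinearIndependent K (cycleFamily K n k) := by
  have hlt (x : Σ i : Fin 3, Fin (n i - 1 - k)) : k + x.2 + 1 < n x.1 := by lia
  refine LinearIndependent.of_pairwise_dual_eq_zero_one _ (fun x => match x with
    | none => socleFunctional hn
    | some x => cycleFunctional hn x.1 (k + x.2 + 1)) ?_ ?_
  · rintro (_ | x) (_ | y) hxy
    · exact absurd rfl hxy
    · exact (socleFunctional_cycleClass hn _ (by lia)).trans (if_neg (hlt y).ne)
    · change cycleFunctional hn x.1 (k + x.2 + 1) (cycleClass K n 0 (n 0)) = 0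
      rw [cycleFunctional_cycleClass hn (hlt x) 0 (hn 0), if_neg]
      exact fun h => (hlt x).ne (h.2.symm.trans (congrArg n h.1.symm))
    · refine (cycleFunctional_cycleClass hn (hlt x) y.1 (by lia)).trans (if_neg ?_)
      obtain ⟨i, a⟩ := x
      obtain ⟨j, b⟩ := y
      rintro ⟨rfl : i = j, h⟩
      exact hxy (by rw [Fin.ext (by lia : (a : ℕ) = b)])
  · rintro (_ | x)
    · exact (socleFunctional_cycleClass hn 0 (hn 0)).trans (if_pos rfl)
    · exact (cycleFunctional_cycleClass hn (hlt x) x.1 (by lia)).trans (if_pos ⟨rfl, rfl⟩)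

lemma span_cycleFamily (hn : ∀ i, 1 ≤ n i) {k : ℕ} (hk : ∃ i, k < n i) :
    Submodule.span K (Set.range (cycleFamily K n k)) = cycleSpan K n k := by
  have hsocle (i j) : cycleClass K n i (n i) = cycleClass K n j (n j) := by
    rw [cycleClass_exponent (hn i), cycleClass_exponent (hn j)]
  refine le_antisymm (Submodule.span_le.2 ?_) (cycleSpan_le_iff.2 fun i m hm => ?_)
  · rintro _ ⟨_ | x, rfl⟩
    · obtain ⟨i, hi⟩ := hk
      change cycleClass K n 0 (n 0) ∈ cycleSpan K n k
      exact hsocle i 0 ▸ cycleClass_mem_cycleSpan i hi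
    · exact cycleClass_mem_cycleSpan x.1 (by lia)
  · rcases lt_trichotomy m (n i) with h | rfl | h
    · obtain ⟨a, rfl⟩ := Nat.exists_eq_add_of_lt hm
      exact Submodule.subset_span ⟨some ⟨i, ⟨a, by lia⟩⟩, rfl⟩
    · exact hsocle 0 i ▸ Submodule.subset_span ⟨none, rfl⟩
    · rw [cycleClass_eq_zero (hn i) h]
      exact zero_mem _

lemma cycleSpan_eq_bot (hn : ∀ i, 1 ≤ n i) {k : ℕ} (hk : ∀ i, n i ≤ k) : cycleSpan K n k = ⊥ :=
  le_bot_iff.1 (cycleSpan_le_iff.2 fun i _ hm =>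
    cycleClass_eq_zero (hn i) ((hk i).trans_lt hm))

/-- The dimension of `cycleSpan K n k`. -/
def filtrationDim (n : Fin 3 → ℕ) (k : ℕ) : ℕ :=
  if ∃ i, k < n i then ∑ i, (n i - 1 - k) + 1 else 0

lemma finrank_cycleSpan (hn : ∀ i, 1 ≤ n i) (k : ℕ) :
    Module.finrank K (cycleSpan K n k) = filtrationDim n k := by
  rw [filtrationDim]
  split_ifs with hk
  · rw [← span_cycleFamily hn hk, finrank_span_eq_card (linearIndependent_cycleFamily hn k)]
    simp
  · rw [cycleSpan_eq_bot hn (by simpa using hk), finrank_bot]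

lemma vtxChar_eq_zero_of_mem_radical (hn : ∀ i, 1 ≤ n i) {z : Subalgebra.center K (Cyc K n)}
    (hz : z ∈ (nilpotentClasses K (Cyc K n)).annihilator.radical) (i : Fin 3) :
    vtxChar i (z : Cyc K n) = 0 := by
  obtain ⟨m, hm⟩ := mem_radical_annihilator.1 hz
  have hmem : cycleClass K n i (n i) ∈ nilpotentClasses K (Cyc K n) := by
    rw [← Submodule.restrictScalars_mem K, restrictScalars_nilpotentClasses_eq_cycleSpan hn]
    exact cycleClass_mem_cycleSpan i (hn i)
  have h := hm _ hmem
  rw [smul_cycleClass_exponent _ (hn i), SubmonoidClass.coe_pow, map_pow] at h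
  exact eq_zero_of_pow_eq_zero ((smul_eq_zero.1 h).resolve_right
    (cycleClass_exponent_ne_zero hn i))

lemma cycles_mem_radical (hn : ∀ i, 1 ≤ n i) (i : Fin 3) :
    cycles K n i ∈ (nilpotentClasses K (Cyc K n)).annihilator.radical :=
  mem_radical_annihilator.2 ⟨n i + 1, fun _ _ => by
    rw [cycles_pow_eq_zero K (hn i) (Nat.lt_succ_self _), zero_smul]⟩

lemma smul_mem_cycleSpan_succ (hn : ∀ i, 1 ≤ n i) {z : Subalgebra.center K (Cyc K n)}
    (hz : z ∈ (nilpotentClasses K (Cyc K n)).annihilator.radical) {k : ℕ}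
    {h : HochschildZero K (Cyc K n)} (hh : h ∈ cycleSpan K n k) :
    z • h ∈ cycleSpan K n (k + 1) := by
  have hle : cycleSpan K n k ≤ (cycleSpan K n (k + 1)).comap
      (Module.toModuleEnd K (HochschildZero K (Cyc K n)) z) := by
    refine cycleSpan_le_iff.2 fun i m hm => ?_
    have hmem := smul_cycleClass_sub_mem z i (Nat.one_le_of_lt hm)
    rw [vtxChar_eq_zero_of_mem_radical hn hz, zero_smul, sub_zero] at hmem
    refine (Submodule.span_le.2 ?_ : _ ≤ cycleSpan K n (k + 1)) hmem
    rintro _ ⟨l, hl, rfl⟩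
    exact cycleClass_mem_cycleSpan i (Nat.lt_of_le_of_lt hm hl)
  exact hle hh

lemma radicalFiltration_le_cycleSpan (hn : ∀ i, 1 ≤ n i) (k : ℕ) :
    (radicalFiltration (nilpotentClasses K (Cyc K n)) k).restrictScalars K ≤ cycleSpan K n k := by
  induction k with
  | zero => rw [radicalFiltration_zero, restrictScalars_nilpotentClasses_eq_cycleSpan hn]
  | succ k ih =>
    intro h hh
    rw [Submodule.restrictScalars_mem, radicalFiltration_succ] at hh
    exact Submodule.smul_induction_on hh
      (fun z hz h hh => smul_mem_cycleSpan_succ hn hz (ih hh)) fun _ _ => add_mem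

lemma cycleClass_mem_radicalFiltration (hn : ∀ i, 1 ≤ n i) (i : Fin 3) {k m : ℕ} (hm : k < m) :
    cycleClass K n i m ∈ radicalFiltration (nilpotentClasses K (Cyc K n)) k := by
  induction k generalizing m with
  | zero =>
    rw [radicalFiltration_zero, ← Submodule.restrictScalars_mem K,
      restrictScalars_nilpotentClasses_eq_cycleSpan hn]
    exact cycleClass_mem_cycleSpan i hm
  | succ k ih =>
    obtain ⟨m, rfl⟩ := Nat.exists_eq_add_of_le (Nat.one_le_of_lt hm)
    rw [radicalFiltration_succ, ← cycles_pow_smul_cycleClass, pow_one]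
    exact Submodule.smul_mem_smul (cycles_mem_radical hn i) (ih (by lia))

lemma finrank_radicalFiltration (hn : ∀ i, 1 ≤ n i) (k : ℕ) :
    Module.finrank K (radicalFiltration (nilpotentClasses K (Cyc K n)) k) = filtrationDim n k := by
  have h : (radicalFiltration (nilpotentClasses K (Cyc K n)) k).restrictScalars K =
      cycleSpan K n k :=
    le_antisymm (radicalFiltration_le_cycleSpan hn k)
      (cycleSpan_le_iff.2 fun i _ hm => cycleClass_mem_radicalFiltration hn i hm)
  rw [← finrank_cycleSpan (K := K) hn, ← h]
  rfl

lemma mem_nilpotentClasses (hn : ∀ i, 1 ≤ n i) {h : HochschildZero K (Cyc K n)}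
    (hh : ∀ χ : Cyc K n →ₐ[K] K, char χ h = 0) : h ∈ nilpotentClasses K (Cyc K n) := by
  rw [← Submodule.restrictScalars_mem K, restrictScalars_nilpotentClasses_eq_cycleSpan hn]
  exact mem_cycleSpan_zero hh

theorem filtrationDim_eq {n' : Fin 3 → ℕ} (hn : ∀ i, 1 ≤ n i) (hn' : ∀ i, 1 ≤ n' i)
    (h : StablyEquivalentOfMoritaType K (Cyc K n) (Cyc K n')) (k : ℕ) :
    filtrationDim n k = filtrationDim n' k := by
  have := finite K hn
  have := finite K hn'
  rw [← finrank_radicalFiltration (K := K) hn, ← finrank_radicalFiltration (K := K) hn']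
  exact h.finrank_radicalFiltration_nilpotentClasses_eq
    (fun _ => mem_nilpotentClasses hn) (fun _ => mem_nilpotentClasses hn') k

lemma one_le_of_le {a b c : ℕ} (hab : b ≤ a) (hbc : c ≤ b) (hc : 1 ≤ c) (i : Fin 3) :
    1 ≤ (![a, c, b] : Fin 3 → ℕ) i := by
  fin_cases i
  exacts [(hc.trans hbc).trans hab, hc, hc.trans hbc]

lemma filtrationDim_of_le {a b c : ℕ} (hab : b ≤ a) (hbc : c ≤ b) (k : ℕ) :
    filtrationDim ![a, c, b] k =
      if k < a then (a - 1 - k) + (c - 1 - k) + (b - 1 - k) + 1 else 0 := by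
  have h : (∃ i, k < (![a, c, b] : Fin 3 → ℕ) i) ↔ k < a := by
    refine ⟨?_, fun h => ⟨0, h⟩⟩
    rintro ⟨i, hi⟩
    fin_cases i
    exacts [hi, hi.trans_le (hbc.trans hab), hi.trans_le hab]
  rw [filtrationDim, Fin.sum_univ_three]
  exact if_congr h rfl rfl

lemma eq_of_filtrationDim_eq {a b c a' b' c' : ℕ} (hab : b ≤ a) (hbc : c ≤ b) (hc : 1 ≤ c)
    (hab' : b' ≤ a') (hbc' : c' ≤ b') (hc' : 1 ≤ c')
    (h : ∀ k, filtrationDim ![a, c, b] k = filtrationDim ![a', c', b'] k) :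
    (a, b, c) = (a', b', c') := by
  simp only [filtrationDim_of_le hab hbc, filtrationDim_of_le hab' hbc'] at h
  obtain rfl : a = a' := by
    have h1 := h a
    have h2 := h a'
    split_ifs at h1 h2 <;> lia
  have hb : b = b' := by
    have h1 := h (b - 1)
    have h2 := h (b' - 1)
    split_ifs at h1 h2 <;> lia
  have hc : c = c' := by
    have h1 := h (c - 1)
    have h2 := h (c' - 1)
    split_ifs at h1 h2 <;> lia
  rw [hb, hc]

end SD3K

theorem corollary5p4_general (K : Type u) [Field K] (a b c a' b' c' : ℕ)
    (hab : b ≤ a) (hbc : c ≤ b) (hc : 1 ≤ c) (hab' : b' ≤ a') (hbc' : c' ≤ b') (hc' : 1 ≤ c') :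
    StablyEquivalentOfMoritaType K (SD3K K a b c) (SD3K K a' b' c') ↔
      (a, b, c) = (a', b', c') := by
  refine ⟨fun h => SD3K.eq_of_filtrationDim_eq hab hbc hc hab' hbc' hc' <|
    SD3K.filtrationDim_eq (SD3K.one_le_of_le hab hbc hc) (SD3K.one_le_of_le hab' hbc' hc') h, ?_⟩
  rintro ⟨⟩
  exact StablyEquivalentOfMoritaType.refl

end

theorem corollary5p4 (K : Type u) [Field K] [IsAlgClosed K] (a b c a' b' c' : ℕ)
    (ha : 2 ≤ a) (hab : b ≤ a) (hbc : c ≤ b) (hc : 1 ≤ c)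
    (ha' : 2 ≤ a') (hab' : b' ≤ a') (hbc' : c' ≤ b') (hc' : 1 ≤ c') :
    StablyEquivalentOfMoritaType K (SD3K K a b c) (SD3K K a' b' c') ↔
      (a, b, c) = (a', b', c') := by
  exact corollary5p4_general K a b c a' b' c' hab hbc hc hab' hbc' hc'
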